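/- Let $\mathsf k$ be an algebraically closed field of characteristic $0$ and let $n\ge 1$. Let $e_1,\dots,e_{n+1}$ be the standard basis of $\mathsf k^{n+1}$, put $E_a=\langle e_1,\dots,e_a\rangle$, and let $Fl_{n+1}$ be the variety of complete flags $U_1\subset\cdots\subset U_n$ ($\dim U_i=i$) in $\mathsf k^{n+1}$. Let $\mathbf F_n\subset Fl_{n+1}$ be the closed subvariety of flags with $U_n=\langle e_2,\dots,e_{n+1}\rangle$. Let $W_{n+1}=S_{n+1}$ with simple reflections $s_i=(i\ i{+}1)$, $1\le i\le n$, and Bruhat order $\le$ ($x\le y$ iff every reduced word for $y$ contains a subword which is a reduced word for $x$). Let $\underline c=s_1s_2\cdots s_n$, and let $c\in W_{n+1}$ be the Coxeter element it represents, so that $c(i)=i+1$ for $i\le n$ and $c(n+1)=1$. For a word $\underline w=s_{i_1}\cdots s_{i_r}$ in $s_1,\dots,s_n$, let $lo(a)$ be the last position $k\in[1,r]$ with $i_k=a$, and for $k\in[1,r]$ let $lp(k)$, resp. $rp(k)$, be the last position $j\le k$ with $i_j=i_k-1$, resp. $i_j=i_k+1$; each is $-\infty$ if there is no such position. The Bott–Samelson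 variety of $\underline w$ is $$X_{\underline w}=\{(V_k)_{k\in[1,r]}\ :\ V_k\subset\mathsf k^{n+1},\ \dim V_k=i_k,\ V_{lp(k)}\subset V_k\subset V_{rp(k)}\},$$ where $V_{lp(k)}=E_{i_k-1}$ if $lp(k)=-\infty$ and $V_{rp(k)}=E_{i_k+1}$ if $rp(k)=-\infty$. It is a variety over $Fl_{n+1}$ through $\pi_{\underline w}\big((V_k)_k\big)=(V_{lo(a)})_{a\in[1,n]}$, where $V_{lo(a)}=E_a$ if $lo(a)=-\infty$. Let also $c$ denote the automorphism $e_i\mapsto e_{c(i)}$ of $\mathsf k^{n+1}$ and the automorphism it induces on $Fl_{n+1}$. For a word $\underline w'$ in $s_1,\dots,s_{n-1}$ put $c(X_{\underline w'})=\{(c(V_k))_k : (V_k)_k\in X_{\underline w'}\}$, a variety over $Fl_{n+1}$ through $c\circ\pi_{\underline w'}\circ c^{-1}$. For a word $\underline u$ in $s_2,\dots,s_n$ let $c^{-1}(\underline u)$ be the word obtained by replacing each letter $s_i$ by $s_{i-1}$. **Theorem.** Let $\underline w$ be a reduced word in $s_1,\dots,s_n$ and $w\in W_{n+1}$ the permutation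 it represents. 1. If $w\not\ge c$, then $X_{\underline w}\times_{Fl_{n+1}}\mathbf F_n$ is empty. 2. If $w\ge c$, then there exist a word $\underline u$ in $s_2,\dots,s_n$ and a word $\underline v$ in $s_1,\dots,s_{n-1}$ such that $\underline w=\underline u\,\underline c\,\underline v$ modulo the commuting relations $s_as_b=s_bs_a$ ($|a-b|\ge2$), and there is an isomorphism of schemes over $Fl_{n+1}$ $$X_{\underline w}\times_{Fl_{n+1}}\mathbf F_n\;\simeq\;c\big(X_{c^{-1}(\underline u)\,\underline v}\big).$$ -/

import Mathlib

universe u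

namespace BottSamelson

open CategoryTheory CategoryTheory.Limits

noncomputable section

/-! ### Words, permutations, Bruhat order

A word `s_{i₁} ⋯ s_{iᵣ}` is encoded by the list `[i₁, …, iᵣ]` of its (1-based) indices. -/

/-- `w` is a word in the simple reflections `s₁, …, sₙ` of `W_{n+1} = S_{n+1}`. -/
def IsWord (n : ℕ) (w : List ℕ) : Prop := ∀ i ∈ w, 1 ≤ i ∧ i ≤ n

/-- The simple reflection `sᵢ`, `1 ≤ i ≤ n`, exchanging the letters `i` and `i + 1`. The letters
`1, …, n + 1` are the elements `0, …, n` of `Fin (n + 1)`. For other `i` a junk value. -/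
def simpleRefl (n i : ℕ) : Equiv.Perm (Fin (n + 1)) :=
  if h : 1 ≤ i ∧ i ≤ n then Equiv.swap ⟨i - 1, by omega⟩ ⟨i, by omega⟩ else 1

/-- The permutation `w ∈ W_{n+1}` represented by a word. -/
def wordPerm (n : ℕ) (w : List ℕ) : Equiv.Perm (Fin (n + 1)) := (w.map (simpleRefl n)).prod

/-- `w` is a reduced word in `s₁, …, sₙ`: no word for the same permutation is shorter. -/
def IsReducedWord (n : ℕ) (w : List ℕ) : Prop :=
  IsWord n w ∧ ∀ w' : List ℕ, IsWord n w' → wordPerm n w' = wordPerm n w → w.length ≤ w'.length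

/-- The Bruhat order: `x ≤ y` iff every reduced word for `y` contains a subword which is a reduced
word for `x`. -/
def BruhatLE (n : ℕ) (x y : Equiv.Perm (Fin (n + 1))) : Prop :=
  ∀ w : List ℕ, IsReducedWord n w → wordPerm n w = y →
    ∃ w' : List ℕ, w'.Sublist w ∧ IsReducedWord n w' ∧ wordPerm n w' = x

/-- One commuting relation `s_a s_b = s_b s_a`, `|a - b| ≥ 2`, applied somewhere in a word. -/
inductive CommStep : List ℕ → List ℕ → Prop
  | swap (x y : List ℕ) (a b : ℕ) (h : a + 2 ≤ b ∨ b + 2 ≤ a) :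
      CommStep (x ++ a :: b :: y) (x ++ b :: a :: y)

/-- Equality of words modulo commuting relations. -/
def CommEquiv : List ℕ → List ℕ → Prop := Relation.EqvGen CommStep

/-- The word `s₁ s₂ ⋯ sₙ`. -/
def coxeterWord (n : ℕ) : List ℕ := List.range' 1 n

/-- The Coxeter element `c = s₁ ⋯ sₙ`, i.e. `c(i) = i + 1` for `1 ≤ i ≤ n` and `c(n + 1) = 1`. -/
def coxeterElt (n : ℕ) : Equiv.Perm (Fin (n + 1)) := wordPerm n (coxeterWord n)

/-- For a word `u` in `s₂, …, sₙ`, the word `c⁻¹(u)`: every `sᵢ` is replaced by `s_{i-1}`. -/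
def shiftWord (u : List ℕ) : List ℕ := u.map (fun i => i - 1)

/-! ### Positions in words -/

/-- The last occurrence of the letter `a` in the word `w` (`⊥` plays the role of `-∞`). -/
def lastOcc (w : List ℕ) (a : ℕ) : WithBot (Fin w.length) :=
  (Finset.univ.filter fun j : Fin w.length => w.get j = a).max

/-- The last occurrence of the letter `a` in the prefix of `w` ending with the `k`-th letter. -/
def lastOccUpTo (w : List ℕ) (k : Fin w.length) (a : ℕ) : WithBot (Fin w.length) :=
  (Finset.univ.filter fun j : Fin w.length => j ≤ k ∧ w.get j = a).max

/-- The left predecessor of the position `k`: the last occurrence of `i_k - 1` up to `k`. -/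
def leftPred (w : List ℕ) (k : Fin w.length) : WithBot (Fin w.length) :=
  lastOccUpTo w k (w.get k - 1)

/-- The right predecessor of the position `k`: the last occurrence of `i_k + 1` up to `k`. -/
def rightPred (w : List ℕ) (k : Fin w.length) : WithBot (Fin w.length) :=
  lastOccUpTo w k (w.get k + 1)

/-! ### Families of subspaces

Varieties over `k` are given by their functors of points on commutative `k`-algebras. An `A`-valued
point of a Grassmannian of subspaces of `k^m` is a submodule of `A^m = (Fin m → A)` which is locally
a direct summand of constant rank. -/

section Modules

variable {A B C : Type u} [CommRing A] [CommRing B] [CommRing C] {m : ℕ}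

/-- `N` is an `A`-point of the Grassmannian of `i`-dimensional subspaces of an `m`-dimensional
space: a direct summand of `A^m` of constant rank `i`. Over a field: a subspace of dimension `i`. -/
structure IsSubbundle (i : ℕ) (N : Submodule A (Fin m → A)) : Prop where
  projective_quotient : Module.Projective A ((Fin m → A) ⧸ N)
  rank_eq : ∀ p : PrimeSpectrum A, Module.rankAtStalk N p = i

/-- The coordinatewise map `A^m → B^m` induced by a ring homomorphism. -/
def mapVec (f : A →+* B) : (Fin m → A) →ₛₗ[f] (Fin m → B) where
  toFun x := fun i => f (x i)
  map_add' x y := by ext i; simp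
  map_smul' a x := by ext i; simp

/-- Base change of a submodule of `A^m` along `f : A → B`: the `B`-span of its image in `B^m`. -/
def baseChange (f : A →+* B) (N : Submodule A (Fin m → A)) : Submodule B (Fin m → B) :=
  Submodule.span B (mapVec f '' (N : Set (Fin m → A)))

/-- `E_a = ⟨e₁, …, e_a⟩`. -/
def stdSub (A : Type u) [CommRing A] (m a : ℕ) : Submodule A (Fin m → A) :=
  Submodule.span A {x | ∃ i : Fin m, (i : ℕ) < a ∧ x = Pi.single i 1}

/-- The hyperplane `⟨e₂, …, e_m⟩`. -/
def hyperplane (A : Type u) [CommRing A] (m : ℕ) : Submodule A (Fin m → A) :=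
  Submodule.span A {x | ∃ i : Fin m, 0 < (i : ℕ) ∧ x = Pi.single i 1}

/-- The automorphism of `A^m` with `e_i ↦ e_{σ(i)}`. -/
def permEquiv (A : Type u) [CommRing A] (σ : Equiv.Perm (Fin m)) : (Fin m → A) ≃ₗ[A] (Fin m → A) :=
  LinearEquiv.funCongrLeft A A σ.symm

/-- The image `σ(N)` of a submodule under `permEquiv A σ`. -/
def permSub (σ : Equiv.Perm (Fin m)) (N : Submodule A (Fin m → A)) : Submodule A (Fin m → A) :=
  N.map (permEquiv A σ).toLinearMap

theorem permEquiv_single (σ : Equiv.Perm (Fin m)) (i : Fin m) :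
    permEquiv A σ (Pi.single i 1) = Pi.single (σ i) 1 := by
  ext j
  simp [permEquiv, LinearEquiv.funCongrLeft_apply, LinearMap.funLeft_apply, Pi.single_apply,
    Equiv.symm_apply_eq]

theorem baseChange_mono (f : A →+* B) {N N' : Submodule A (Fin m → A)} (h : N ≤ N') :
    baseChange f N ≤ baseChange f N' :=
  Submodule.span_mono (Set.image_mono h)

theorem baseChange_span (f : A →+* B) (S : Set (Fin m → A)) :
    baseChange f (Submodule.span A S) = Submodule.span B (mapVec f '' S) := by
  apply le_antisymm
  · refine Submodule.span_le.2 ?_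
    rintro _ ⟨x, hx, rfl⟩
    have h : Submodule.span A S ≤ (Submodule.span B (mapVec f '' S)).comap (mapVec f) := by
      refine Submodule.span_le.2 fun y hy => ?_
      exact Submodule.subset_span ⟨y, hy, rfl⟩
    exact h hx
  · exact Submodule.span_mono (Set.image_mono Submodule.subset_span)

theorem baseChange_id (N : Submodule A (Fin m → A)) : baseChange (RingHom.id A) N = N := by
  have : mapVec (RingHom.id A) '' (N : Set (Fin m → A)) = N := by
    ext x; constructor
    · rintro ⟨y, hy, rfl⟩; exact hy
    · intro hx; exact ⟨x, hx, rfl⟩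
  rw [baseChange, this, Submodule.span_eq]

theorem baseChange_comp (f : A →+* B) (g : B →+* C) (N : Submodule A (Fin m → A)) :
    baseChange (g.comp f) N = baseChange g (baseChange f N) := by
  conv_rhs => rw [baseChange, baseChange]
  have := baseChange_span g (mapVec f '' (N : Set (Fin m → A)))
  rw [baseChange] at this
  rw [this, baseChange, Set.image_image]
  rfl

theorem mapVec_single (f : A →+* B) (i : Fin m) :
    mapVec f (Pi.single i 1) = (Pi.single i 1 : Fin m → B) := by
  ext j
  by_cases h : j = i
  · subst h; simp [mapVec]
  · simp [mapVec, h]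

theorem baseChange_span_single (f : A →+* B) (P : Fin m → Prop) :
    baseChange f (Submodule.span A {x | ∃ i : Fin m, P i ∧ x = Pi.single i 1}) =
      Submodule.span B {x | ∃ i : Fin m, P i ∧ x = Pi.single i 1} := by
  rw [baseChange_span]
  congr 1
  ext x; constructor
  · rintro ⟨_, ⟨i, hi, rfl⟩, rfl⟩
    exact ⟨i, hi, mapVec_single f i⟩
  · rintro ⟨i, hi, rfl⟩
    exact ⟨_, ⟨i, hi, rfl⟩, mapVec_single f i⟩

theorem baseChange_stdSub (f : A →+* B) (a : ℕ) :
    baseChange f (stdSub A m a) = stdSub B m a :=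
  baseChange_span_single f _

theorem baseChange_hyperplane (f : A →+* B) :
    baseChange f (hyperplane A m) = hyperplane B m :=
  baseChange_span_single f _

theorem baseChange_permSub (f : A →+* B) (σ : Equiv.Perm (Fin m)) (N : Submodule A (Fin m → A)) :
    baseChange f (permSub σ N) = permSub σ (baseChange f N) := by
  rw [permSub, permSub, baseChange, baseChange, Submodule.map_span, Submodule.map_coe,
    Set.image_image, Set.image_image]
  rfl

theorem permSub_mono (σ : Equiv.Perm (Fin m)) {N N' : Submodule A (Fin m → A)} (h : N ≤ N') :
    permSub σ N ≤ permSub σ N' :=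
  Submodule.map_mono h

theorem IsSubbundle.permSub {i : ℕ} {N : Submodule A (Fin m → A)} (h : IsSubbundle i N)
    (σ : Equiv.Perm (Fin m)) : IsSubbundle i (permSub σ N) where
  projective_quotient :=
    have := h.projective_quotient
    Module.Projective.of_equiv (Submodule.Quotient.equiv N _ (permEquiv A σ) rfl)
  rank_eq p := by
    rw [← h.rank_eq p]
    exact (congrFun (Module.rankAtStalk_eq_of_equiv ((permEquiv A σ).submoduleMap N)) p).symm

theorem IsSubbundle.exists_retraction {i : ℕ} {N : Submodule A (Fin m → A)} (h : IsSubbundle i N) :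
    ∃ r : (Fin m → A) →ₗ[A] N, r ∘ₗ N.subtype = LinearMap.id := by
  have := h.projective_quotient
  obtain ⟨s, hs⟩ := Module.projective_lifting_property N.mkQ LinearMap.id N.mkQ_surjective
  have hmem : ∀ x, ((LinearMap.id : (Fin m → A) →ₗ[A] _) - s ∘ₗ N.mkQ) x ∈ N := fun x => by
    rw [← Submodule.Quotient.mk_eq_zero, ← Submodule.mkQ_apply]
    have := LinearMap.congr_fun hs (N.mkQ x)
    simp only [LinearMap.comp_apply, LinearMap.id_apply] at this
    simp only [LinearMap.sub_apply, LinearMap.id_apply, LinearMap.comp_apply, map_sub, this,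
      sub_self]
  refine ⟨LinearMap.codRestrict N _ hmem, LinearMap.ext fun x => Subtype.ext ?_⟩
  have : N.mkQ (x : Fin m → A) = 0 := by simp
  simp [LinearMap.comp_apply, this]

open TensorProduct in
theorem IsSubbundle.baseChange {i : ℕ} {N : Submodule A (Fin m → A)} (h : IsSubbundle i N)
    (f : A →+* B) : IsSubbundle i (baseChange f N) := by
  let _ : Algebra A B := f.toAlgebra
  have hproj := h.projective_quotient
  obtain ⟨r, hr⟩ := h.exists_retraction
  have hrs : Function.Surjective r := fun x => ⟨x, LinearMap.congr_fun hr x⟩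
  have hfin : Module.Finite A N := Module.Finite.of_surjective r hrs
  have hprojN : Module.Projective A N := Module.Projective.of_split N.subtype r hr
  let e : B ⊗[A] (Fin m → A) ≃ₗ[B] (Fin m → B) := TensorProduct.piScalarRight A B B (Fin m)
  have he : ∀ (b : B) (x : Fin m → A), e (b ⊗ₜ x) = b • mapVec f x := by
    intro b x
    ext j
    simp [e, TensorProduct.piScalarRight_apply, mapVec, Algebra.smul_def, mul_comm,
      RingHom.algebraMap_toAlgebra]
  let j : B ⊗[A] N →ₗ[B] (Fin m → B) := e.toLinearMap ∘ₗ N.subtype.baseChange B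
  have hj : Function.Injective j := by
    refine e.injective.comp ?_
    refine Function.LeftInverse.injective (g := r.baseChange B) fun x => ?_
    rw [← LinearMap.comp_apply, ← LinearMap.baseChange_comp, hr, LinearMap.baseChange_id]
    rfl
  have hrange : LinearMap.range j = BottSamelson.baseChange f N := by
    apply le_antisymm
    · rintro _ ⟨x, rfl⟩
      induction x using TensorProduct.induction_on with
      | zero => simp
      | tmul b y =>
        have : j (b ⊗ₜ y) = b • mapVec f (y : Fin m → A) := he b y
        rw [this]
        exact Submodule.smul_mem _ _ (Submodule.subset_span ⟨y, y.2, rfl⟩)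
      | add x y hx hy => rw [map_add]; exact add_mem hx hy
    · refine Submodule.span_le.2 ?_
      rintro _ ⟨x, hx, rfl⟩
      refine ⟨1 ⊗ₜ ⟨x, hx⟩, ?_⟩
      have : j (1 ⊗ₜ ⟨x, hx⟩) = (1 : B) • mapVec f x := he 1 x
      rw [this, one_smul]
  let q : (Fin m → B) →ₗ[B] B ⊗[A] ((Fin m → A) ⧸ N) :=
    N.mkQ.baseChange B ∘ₗ e.symm.toLinearMap
  have hq : Function.Surjective q :=
    (LinearMap.baseChange_surjective B N.mkQ_surjective).comp e.symm.surjective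
  have hex : Function.Exact (N.subtype.lTensor B) (N.mkQ.lTensor B) :=
    lTensor_exact B (LinearMap.exact_subtype_mkQ N) N.mkQ_surjective
  have hker : LinearMap.ker q = BottSamelson.baseChange f N := by
    rw [← hrange]
    ext x
    constructor
    · intro hx
      obtain ⟨y, hy⟩ := (hex (e.symm x)).1 hx
      refine ⟨y, ?_⟩
      have : j y = e (N.subtype.lTensor B y) := rfl
      rw [this, hy, e.apply_symm_apply]
    · rintro ⟨y, rfl⟩
      have h1 : q (j y) = N.mkQ.lTensor B (e.symm (e (N.subtype.lTensor B y))) := rfl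
      rw [LinearMap.mem_ker, h1, e.symm_apply_apply]
      exact (hex _).2 ⟨y, rfl⟩
  constructor
  · have e1 := q.quotKerEquivOfSurjective hq
    rw [hker] at e1
    exact Module.Projective.of_equiv e1.symm
  · intro p
    have e2 := LinearEquiv.ofInjective j hj
    rw [hrange] at e2
    rw [← Module.rankAtStalk_eq_of_equiv e2, Module.rankAtStalk_baseChange, h.rank_eq]

theorem isSubbundle_stdSub {a : ℕ} (ha : a ≤ m) : IsSubbundle a (stdSub A m a) := by
  let ρ : (Fin m → A) →ₗ[A] ({i : Fin m // ¬ (i : ℕ) < a} → A) :=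
    LinearMap.funLeft A A Subtype.val
  let ι : (Fin m → A) →ₗ[A] ({i : Fin m // (i : ℕ) < a} → A) := LinearMap.funLeft A A Subtype.val
  have hρs : Function.Surjective ρ :=
    LinearMap.funLeft_surjective_of_injective A A _ Subtype.val_injective
  have hker : LinearMap.ker ρ = stdSub A m a := by
    apply le_antisymm
    · intro x hx
      have hx' : ∀ i : Fin m, ¬ (i : ℕ) < a → x i = 0 := fun i hi => congrFun hx ⟨i, hi⟩
      rw [show x = ∑ i, x i • (Pi.single i 1 : Fin m → A) from by
        ext j; simp [Finset.sum_apply, Pi.single_apply]]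
      refine Submodule.sum_mem _ fun i _ => ?_
      by_cases hi : (i : ℕ) < a
      · exact Submodule.smul_mem _ _ (Submodule.subset_span ⟨i, hi, rfl⟩)
      · rw [hx' i hi, zero_smul]; exact zero_mem _
    · refine Submodule.span_le.2 ?_
      rintro _ ⟨i, hi, rfl⟩
      change ρ (Pi.single i 1) = 0
      ext ⟨j, hj⟩
      have : j ≠ i := by rintro rfl; exact hj hi
      simp [ρ, LinearMap.funLeft_apply, this]
  constructor
  · have e1 := ρ.quotKerEquivOfSurjective hρs
    rw [hker] at e1
    exact Module.Projective.of_equiv e1.symm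
  · intro p
    have : Nontrivial A := p.nontrivial
    let t : stdSub A m a →ₗ[A] ({i : Fin m // (i : ℕ) < a} → A) := ι ∘ₗ (stdSub A m a).subtype
    have ht : Function.Bijective t := by
      constructor
      · rw [injective_iff_map_eq_zero]
        rintro ⟨x, hx⟩ h0
        ext i
        by_cases hi : (i : ℕ) < a
        · exact congrFun h0 ⟨i, hi⟩
        · rw [← hker] at hx
          exact congrFun (show ρ x = 0 from hx) ⟨i, hi⟩
      · intro y
        refine ⟨⟨fun i => if hi : (i : ℕ) < a then y ⟨i, hi⟩ else 0, ?_⟩, ?_⟩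
        · rw [← hker]
          change ρ _ = 0
          ext ⟨i, hi⟩
          simp [ρ, LinearMap.funLeft_apply, hi]
        · ext ⟨i, hi⟩
          simp [t, ι, LinearMap.funLeft_apply, hi]
    rw [Module.rankAtStalk_eq_of_equiv (LinearEquiv.ofBijective t ht),
      Module.rankAtStalk_eq_finrank_of_free, Module.finrank_fintype_fun_eq_card,
      Fintype.card_subtype]
    change (Finset.univ.filter fun i : Fin m => (i : ℕ) < a).card = a
    rw [Fin.card_filter_val_lt]
    omega

/-- The member `V_o` of a family `V`, with the convention `V_{-∞} = E_a`. -/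
def member {r : ℕ} (V : Fin r → Submodule A (Fin m → A)) (a : ℕ) (o : WithBot (Fin r)) :
    Submodule A (Fin m → A) :=
  WithBot.recBotCoe (stdSub A m a) V o

theorem baseChange_member (f : A →+* B) {r : ℕ} (V : Fin r → Submodule A (Fin m → A)) (a : ℕ)
    (o : WithBot (Fin r)) :
    baseChange f (member V a o) = member (fun k => baseChange f (V k)) a o := by
  induction o using WithBot.recBotCoe with
  | bot => exact baseChange_stdSub f a
  | coe j => rfl

/-- `U = (U₀ ⊆ U₁ ⊆ ⋯ ⊆ U_{n+1})` is an `A`-point of the variety of complete flags in `k^{n+1}`.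
(Necessarily `U₀ = 0` and `U_{n+1} = A^{n+1}`.) -/
structure IsFlag (n : ℕ) (U : Fin (n + 2) → Submodule A (Fin (n + 1) → A)) : Prop where
  isSubbundle : ∀ a : Fin (n + 2), IsSubbundle (a : ℕ) (U a)
  le_succ : ∀ a : Fin (n + 1), U a.castSucc ≤ U a.succ

/-- `V = (V_k)_k` is an `A`-point of the Bott--Samelson variety of the word `w`. -/
structure IsBS (n : ℕ) (w : List ℕ) (V : Fin w.length → Submodule A (Fin (n + 1) → A)) :
    Prop where
  isSubbundle : ∀ k, IsSubbundle (w.get k) (V k)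
  left_le : ∀ k, member V (w.get k - 1) (leftPred w k) ≤ V k
  le_right : ∀ k, V k ≤ member V (w.get k + 1) (rightPred w k)

theorem IsFlag.baseChange {n : ℕ} {U : Fin (n + 2) → Submodule A (Fin (n + 1) → A)}
    (h : IsFlag n U) (f : A →+* B) : IsFlag n fun a => baseChange f (U a) where
  isSubbundle a := (h.isSubbundle a).baseChange f
  le_succ a := baseChange_mono f (h.le_succ a)

theorem IsFlag.permSub {n : ℕ} {U : Fin (n + 2) → Submodule A (Fin (n + 1) → A)}
    (h : IsFlag n U) (σ : Equiv.Perm (Fin (n + 1))) : IsFlag n fun a => permSub σ (U a) where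
  isSubbundle a := (h.isSubbundle a).permSub σ
  le_succ a := permSub_mono σ (h.le_succ a)

theorem IsBS.baseChange {n : ℕ} {w : List ℕ} {V : Fin w.length → Submodule A (Fin (n + 1) → A)}
    (h : IsBS n w V) (f : A →+* B) : IsBS n w fun k => baseChange f (V k) where
  isSubbundle k := (h.isSubbundle k).baseChange f
  left_le k := by
    rw [← baseChange_member]
    exact baseChange_mono f (h.left_le k)
  le_right k := by
    rw [← baseChange_member]
    exact baseChange_mono f (h.le_right k)

theorem lastOcc_spec {w : List ℕ} {a : ℕ} {j : Fin w.length} (h : lastOcc w a = j) :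
    w.get j = a ∧ ∀ i, w.get i = a → i ≤ j := by
  refine ⟨by simpa using Finset.mem_of_max h, fun i hi => ?_⟩
  exact Finset.le_max_of_eq (by simpa using hi) h

theorem lastOcc_eq_bot {w : List ℕ} {a : ℕ} (h : lastOcc w a = ⊥) (i : Fin w.length) :
    w.get i ≠ a := by
  rw [lastOcc, Finset.max_eq_bot, Finset.filter_eq_empty_iff] at h
  exact h (Finset.mem_univ i)

theorem lastOccUpTo_eq_bot {w : List ℕ} {a : ℕ} (h : lastOcc w a = ⊥) (k : Fin w.length) :
    lastOccUpTo w k a = ⊥ := by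
  rw [lastOccUpTo, Finset.max_eq_bot, Finset.filter_eq_empty_iff]
  exact fun i _ hi => lastOcc_eq_bot h i hi.2

theorem lastOccUpTo_eq {w : List ℕ} {a : ℕ} {j : Fin w.length} (h : lastOcc w a = j)
    {k : Fin w.length} (hk : j ≤ k) : lastOccUpTo w k a = j := by
  have hj := lastOcc_spec h
  apply le_antisymm
  · refine Finset.max_le fun i hi => ?_
    simp only [Finset.mem_filter, Finset.mem_univ, true_and] at hi
    exact WithBot.coe_le_coe.2 (hj.2 i hi.2)
  · exact Finset.le_max (by simpa using ⟨hk, hj.1⟩)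

theorem stdSub_mono {a b : ℕ} (h : a ≤ b) : stdSub A m a ≤ stdSub A m b :=
  Submodule.span_mono fun _ ⟨i, hi, hx⟩ => ⟨i, lt_of_lt_of_le hi h, hx⟩

theorem IsBS.isFlag {n : ℕ} {w : List ℕ} {V : Fin w.length → Submodule A (Fin (n + 1) → A)}
    (h : IsBS n w V) : IsFlag n fun a : Fin (n + 2) => member V (a : ℕ) (lastOcc w a) where
  isSubbundle a := by
    cases ho : lastOcc w (a : ℕ) using WithBot.recBotCoe with
    | bot => exact isSubbundle_stdSub (Nat.le_of_lt_succ a.2)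
    | coe j => exact (lastOcc_spec ho).1 ▸ h.isSubbundle j
  le_succ a := by
    simp only [Fin.val_castSucc, Fin.val_succ]
    cases ho : lastOcc w (a : ℕ) using WithBot.recBotCoe with
    | bot =>
      cases ho' : lastOcc w ((a : ℕ) + 1) using WithBot.recBotCoe with
      | bot => exact stdSub_mono (Nat.le_succ _)
      | coe j' =>
        have h1 := h.left_le j'
        rw [leftPred, (lastOcc_spec ho').1, Nat.add_sub_cancel, lastOccUpTo_eq_bot ho] at h1
        exact h1
    | coe j =>
      cases ho' : lastOcc w ((a : ℕ) + 1) using WithBot.recBotCoe with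
      | bot =>
        have h1 := h.le_right j
        rw [rightPred, (lastOcc_spec ho).1, lastOccUpTo_eq_bot ho'] at h1
        exact h1
      | coe j' =>
        rcases le_total j j' with hjj | hjj
        · have h1 := h.left_le j'
          rw [leftPred, (lastOcc_spec ho').1, Nat.add_sub_cancel, lastOccUpTo_eq ho hjj] at h1
          exact h1
        · have h1 := h.le_right j
          rw [rightPred, (lastOcc_spec ho).1, lastOccUpTo_eq ho' hjj] at h1
          exact h1

theorem permSub_symm_permSub (σ : Equiv.Perm (Fin m)) (N : Submodule A (Fin m → A)) :
    permSub σ.symm (permSub σ N) = N := by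
  rw [permSub, permSub, ← Submodule.map_comp]
  convert Submodule.map_id N
  ext x j
  simp [permEquiv, LinearMap.funLeft_apply]

theorem permSub_permSub_symm (σ : Equiv.Perm (Fin m)) (N : Submodule A (Fin m → A)) :
    permSub σ (permSub σ.symm N) = N := by
  simpa using permSub_symm_permSub σ.symm N

end Modules

/-! ### The varieties, as functors on commutative `k`-algebras -/

section Varieties

variable (k : Type u) [Field k] (n : ℕ)

/-- The variety `Fl_{n+1}` of complete flags in `k^{n+1}`. -/
def flagVariety : CommAlgCat.{u} k ⥤ Type u where
  obj A := {U : Fin (n + 2) → Submodule A (Fin (n + 1) → A) // IsFlag n U}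
  map f := ↾fun U => ⟨fun a => baseChange f.hom.toRingHom (U.1 a), U.2.baseChange _⟩
  map_id A := by
    refine ConcreteCategory.hom_ext _ _ fun U => ?_
    exact Subtype.ext (funext fun a => baseChange_id _)
  map_comp f g := by
    refine ConcreteCategory.hom_ext _ _ fun U => ?_
    exact Subtype.ext (funext fun a => baseChange_comp _ _ _)

/-- The subvariety `𝐅_n = {U ∈ Fl_{n+1} | U_n = ⟨e₂, …, e_{n+1}⟩}` of `Fl_{n+1}`. -/
def subflagVariety : CommAlgCat.{u} k ⥤ Type u where
  obj A := {U : Fin (n + 2) → Submodule A (Fin (n + 1) → A) //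
    IsFlag n U ∧ U (Fin.last n).castSucc = hyperplane A (n + 1)}
  map f := ↾fun U => ⟨fun a => baseChange f.hom.toRingHom (U.1 a), U.2.1.baseChange _, by
    simp only [U.2.2, baseChange_hyperplane]⟩
  map_id A := by
    refine ConcreteCategory.hom_ext _ _ fun U => ?_
    exact Subtype.ext (funext fun a => baseChange_id _)
  map_comp f g := by
    refine ConcreteCategory.hom_ext _ _ fun U => ?_
    exact Subtype.ext (funext fun a => baseChange_comp _ _ _)

/-- The inclusion of `𝐅_n` in `Fl_{n+1}`. -/
def subflagIncl : subflagVariety k n ⟶ flagVariety k n where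
  app _ := ↾fun U => ⟨U.1, U.2.1⟩
  naturality _ _ _ := rfl

/-- The automorphism of `Fl_{n+1}` induced by `c : e_i ↦ e_{c(i)}`. -/
def rotateFlag : flagVariety k n ⟶ flagVariety k n where
  app A := ↾fun U => ⟨fun a => permSub (coxeterElt n) (U.1 a), U.2.permSub _⟩
  naturality A B f := by
    refine ConcreteCategory.hom_ext _ _ fun U => ?_
    exact Subtype.ext (funext fun a => (baseChange_permSub _ _ _).symm)

variable (w : List ℕ)

/-- The Bott--Samelson variety `X_w` of the word `w = s_{i₁} ⋯ s_{iᵣ}`: families `(V_k)` with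
`dim V_k = i_k` and `V_{lp(k)} ⊆ V_k ⊆ V_{rp(k)}`. -/
def bottSamelson : CommAlgCat.{u} k ⥤ Type u where
  obj A := {V : Fin w.length → Submodule A (Fin (n + 1) → A) // IsBS n w V}
  map f := ↾fun V => ⟨fun j => baseChange f.hom.toRingHom (V.1 j), V.2.baseChange _⟩
  map_id A := by
    refine ConcreteCategory.hom_ext _ _ fun V => ?_
    exact Subtype.ext (funext fun a => baseChange_id _)
  map_comp f g := by
    refine ConcreteCategory.hom_ext _ _ fun V => ?_
    exact Subtype.ext (funext fun a => baseChange_comp _ _ _)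

/-- The morphism `π_w : X_w → Fl_{n+1}`, `(V_k) ↦ (V_{lo(a)})_a`, where `lo(a)` is the last
occurrence of `a` in `w` and `V_{-∞} = E_a`. -/
def bsToFlag : bottSamelson k n w ⟶ flagVariety k n where
  app A := ↾fun V => ⟨fun a => member V.1 (a : ℕ) (lastOcc w a), V.2.isFlag⟩
  naturality A B f := by
    refine ConcreteCategory.hom_ext _ _ fun V => ?_
    exact Subtype.ext (funext fun a => (baseChange_member _ _ _ _).symm)

/-- The variety `c(X_w) = {(c(V_k))_k | (V_k)_k ∈ X_w}`. -/
def rotatedBS : CommAlgCat.{u} k ⥤ Type u where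
  obj A := {H : Fin w.length → Submodule A (Fin (n + 1) → A) //
    ∃ V, IsBS n w V ∧ ∀ j, H j = permSub (coxeterElt n) (V j)}
  map f := ↾fun H => ⟨fun j => baseChange f.hom.toRingHom (H.1 j), by
    obtain ⟨V, hV, hH⟩ := H.2
    exact ⟨_, hV.baseChange f.hom.toRingHom, fun j => by
      simp only [hH, baseChange_permSub]⟩⟩
  map_id A := by
    refine ConcreteCategory.hom_ext _ _ fun V => ?_
    exact Subtype.ext (funext fun a => baseChange_id _)
  map_comp f g := by
    refine ConcreteCategory.hom_ext _ _ fun V => ?_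
    exact Subtype.ext (funext fun a => baseChange_comp _ _ _)

/-- The isomorphism `c⁻¹ : c(X_w) → X_w`. -/
def unrotateBS : rotatedBS k n w ⟶ bottSamelson k n w where
  app A := ↾fun H => ⟨fun j => permSub (coxeterElt n).symm (H.1 j), by
    obtain ⟨V, hV, hH⟩ := H.2
    have : (fun j => permSub (coxeterElt n).symm (H.1 j)) = V :=
      funext fun j => by rw [hH, permSub_symm_permSub]
    exact this ▸ hV⟩
  naturality A B f := by
    refine ConcreteCategory.hom_ext _ _ fun V => ?_
    exact Subtype.ext (funext fun a => (baseChange_permSub _ _ _).symm)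

/-- The structure morphism `c(π_w) = c ∘ π_w ∘ c⁻¹ : c(X_w) → Fl_{n+1}`. -/
def rotatedBSToFlag : rotatedBS k n w ⟶ flagVariety k n :=
  unrotateBS k n w ≫ bsToFlag k n w ≫ rotateFlag k n

end Varieties

/-- A variety, given by its functor of points, is empty iff it has no points with values in any
nonzero algebra. -/
def IsEmptyVariety {k : Type u} [Field k] (X : CommAlgCat.{u} k ⥤ Type u) : Prop :=
  ∀ A : CommAlgCat.{u} k, Nontrivial A → IsEmpty (X.obj A)

end

end BottSamelson

open CategoryTheory CategoryTheory.Limits BottSamelson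

namespace BottSamelson

/-! ### Words modulo commutation -/

/-! The combinatorial side follows the largest letter `n + 1` through the suffixes of `w`. In any
word, bringing it down to the value 1 uses up a subword `s₁ ⋯ sₙ` (`range'_sublist_of_lastVal`). In
a reduced word it never moves up, since two letters cannot cross twice (`IsReducedWord.descending`);
so conversely the subword `s₁ ⋯ sₙ` forces `w(n + 1) = 1`. Hence `w ≥ c`, `w(n + 1) = 1` and "the
reduced word contains `s₁ ⋯ sₙ`" are equivalent. Sorting the remaining letters by whether they act
above or below the current position of `n + 1` gives the factorization `u c v` up to commutation
(`Descending.exists_commEquiv`).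

On the geometric side, a point of `X_w` is a gallery: starting from the standard flag, each letter
`s_i` replaces the `i`-th member of the current flag (`isBS_iff`). The vector `e₁` can only be
expelled from the members one index at a time, so a gallery ending in a flag through `⟨e₂, …,
e_{n+1}⟩` has a type containing `s₁ ⋯ sₙ` (`IsGallery.range'_sublist`). This gives emptiness.

For a word `u c v`, the letters of `u` never touch the first member `⟨e₁⟩`. Adding this line, or
intersecting with `⟨e₂, …, e_{n+1}⟩`, therefore matches galleries of type `u` from the standard flag
with galleries of type `c⁻¹(u)` from its rotation, because `E_{a+1} = ⟨e₁⟩ ⊕ c(E_a)`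
(`IsGallery.lift`, `IsGallery.exists_lift`). Since `v` does not contain `sₙ`, the `n`-th member is
already the hyperplane after `c`. The members inserted along `c` increase, so all of them lie in the
hyperplane, and a rank comparison determines them (`IsMixed.eq_of_isGallery`). They form exactly the
flag reached on the rotated side, and `v` then acts in the same way on both sides.

All of this holds over every commutative `k`-algebra and is compatible with base change, so it gives
a pullback square of functors (`isPullback_expandBS`). Commuting relations permute the coordinates
of `X_w` without changing its conditions (`Reordering.bsIso`). -/

theorem CommStep.append {x y : List ℕ} (h : CommStep x y) (a b : List ℕ) :
    CommStep (a ++ x ++ b) (a ++ y ++ b) := by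
  obtain ⟨p, q, i, j, hij⟩ := h
  have := CommStep.swap (a ++ p) (q ++ b) i j hij
  simpa using this

theorem CommEquiv.refl (x : List ℕ) : CommEquiv x x := Relation.EqvGen.refl x

theorem CommEquiv.trans {x y z : List ℕ} (h : CommEquiv x y) (h' : CommEquiv y z) :
    CommEquiv x z := Relation.EqvGen.trans _ _ _ h h'

theorem CommEquiv.append {x y : List ℕ} (h : CommEquiv x y) (a b : List ℕ) :
    CommEquiv (a ++ x ++ b) (a ++ y ++ b) := by
  induction h with
  | rel _ _ h => exact Relation.EqvGen.rel _ _ (h.append a b)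
  | refl => exact CommEquiv.refl _
  | symm _ _ _ ih => exact Relation.EqvGen.symm _ _ ih
  | trans _ _ _ _ _ ih ih' => exact ih.trans ih'

theorem CommEquiv.perm {x y : List ℕ} (h : CommEquiv x y) : x.Perm y := by
  induction h with
  | rel _ _ h =>
    obtain ⟨p, q, i, j, -⟩ := h
    exact (List.Perm.swap j i q).append_left p
  | refl => exact List.Perm.refl _
  | symm _ _ _ ih => exact ih.symm
  | trans _ _ _ _ _ ih ih' => exact ih.trans ih'

theorem commEquiv_cons_append (a : ℕ) (x y : List ℕ)
    (h : ∀ b ∈ x, a + 2 ≤ b ∨ b + 2 ≤ a) : CommEquiv (a :: (x ++ y)) (x ++ a :: y) := by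
  induction x with
  | nil => exact CommEquiv.refl _
  | cons b x ih =>
    have h1 : CommEquiv (a :: b :: (x ++ y)) (b :: a :: (x ++ y)) :=
      Relation.EqvGen.rel _ _ (CommStep.swap [] (x ++ y) a b (h b (by simp)))
    have h2 := (ih fun b hb => h b (by simp [hb])).append [b] []
    simp only [List.append_nil, List.singleton_append] at h2
    exact h1.trans h2

/-! ### The trajectory of the largest letter -/

theorem wordPerm_cons (n i : ℕ) (w : List ℕ) :
    wordPerm n (i :: w) = simpleRefl n i * wordPerm n w := by
  simp [wordPerm]

theorem wordPerm_append (n : ℕ) (x y : List ℕ) :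
    wordPerm n (x ++ y) = wordPerm n x * wordPerm n y := by
  simp [wordPerm]

theorem simpleRefl_apply_val {n i : ℕ} (hi : 1 ≤ i ∧ i ≤ n) (x : Fin (n + 1)) :
    (simpleRefl n i x : ℕ) = if (x : ℕ) = i then i - 1 else if (x : ℕ) = i - 1 then i else x := by
  rw [simpleRefl, dif_pos hi, Equiv.swap_apply_def]
  simp only [Fin.ext_iff]
  split_ifs <;> first | rfl | omega

/-- The image of the largest letter `n + 1` under `wordPerm n w`, counted from `0`. -/
def lastVal (n : ℕ) (w : List ℕ) : ℕ := wordPerm n w (Fin.last n)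

theorem lastVal_nil (n : ℕ) : lastVal n [] = n := by simp [lastVal, wordPerm]

theorem lastVal_le (n : ℕ) (w : List ℕ) : lastVal n w ≤ n :=
  Nat.le_of_lt_succ (wordPerm n w (Fin.last n)).2

theorem lastVal_cons {n i : ℕ} (hi : 1 ≤ i ∧ i ≤ n) (w : List ℕ) :
    lastVal n (i :: w) =
      if lastVal n w = i then i - 1 else if lastVal n w = i - 1 then i else lastVal n w := by
  rw [lastVal, wordPerm_cons, Equiv.Perm.mul_apply, simpleRefl_apply_val hi, lastVal]

/-- Each step down of the largest letter from `i` to `i - 1` prepends `s_i` to the subword found so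
far; a step up discards its first letter. Reducedness plays no role. -/
theorem range'_sublist_of_lastVal {n : ℕ} {w : List ℕ} (hw : IsWord n w) :
    (List.range' (lastVal n w + 1) (n - lastVal n w)).Sublist w := by
  induction w with
  | nil => simp [lastVal_nil]
  | cons i w ih =>
    have hi := hw i (by simp)
    have ih := ih fun j hj => hw j (by simp [hj])
    have hle := lastVal_le n w
    rw [lastVal_cons hi]
    split_ifs with h1 h2
    · have : n - (i - 1) = (n - i) + 1 := by omega
      rw [this, List.range'_succ, Nat.sub_add_cancel hi.1]
      exact (h1 ▸ ih).cons_cons i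
    · rw [h2, Nat.sub_add_cancel hi.1] at ih
      have : n - (i - 1) = (n - i) + 1 := by omega
      rw [this, List.range'_succ] at ih
      exact ((List.sublist_cons_self _ _).trans ih).cons i
    · exact ih.cons i

theorem coxeterWord_sublist {n : ℕ} {w : List ℕ} (hw : IsWord n w) (h : lastVal n w = 0) :
    (coxeterWord n).Sublist w := by
  have := range'_sublist_of_lastVal hw
  rwa [h] at this

/-- The trajectory of the largest letter under the suffixes of `w` never increases. -/
def Descending (n : ℕ) (w : List ℕ) : Prop :=
  ∀ x i z, w = x ++ i :: z → lastVal n z ≠ i - 1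

theorem Descending.of_cons {n i : ℕ} {w : List ℕ} (h : Descending n (i :: w)) :
    Descending n w := fun x j z hz => h (i :: x) j z (by simp [hz])

/-- A simple reflection reverses the order of two values only if it exchanges exactly these two, so
the crossing occurs at the letter where the order first reverses, reading from the right. -/
theorem exists_crossing {n : ℕ} {a b : Fin (n + 1)} (hab : a < b) {z : List ℕ}
    (hz : wordPerm n z b < wordPerm n z a) : ∃ x i y, z = x ++ i :: y ∧ 1 ≤ i ∧ i ≤ n ∧
      (wordPerm n y a : ℕ) = i - 1 ∧ (wordPerm n y b : ℕ) = i := by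
  induction z with
  | nil => simp [wordPerm] at hz; omega
  | cons i z ih =>
    by_cases h : wordPerm n z b < wordPerm n z a
    · obtain ⟨x, j, y, rfl, hj⟩ := ih h
      exact ⟨i :: x, j, y, rfl, hj⟩
    · have hne : wordPerm n z a ≠ wordPerm n z b := fun h => hab.ne ((wordPerm n z).injective h)
      have hlt : (wordPerm n z a : ℕ) < wordPerm n z b := by
        have : (wordPerm n z a : ℕ) ≠ wordPerm n z b := fun h => hne (Fin.ext h)
        rw [Fin.lt_def] at h
        omega
      rw [wordPerm_cons, Equiv.Perm.mul_apply, Equiv.Perm.mul_apply, Fin.lt_def] at hz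
      by_cases hi : 1 ≤ i ∧ i ≤ n
      · rw [simpleRefl_apply_val hi, simpleRefl_apply_val hi] at hz
        refine ⟨[], i, z, rfl, hi.1, hi.2, ?_⟩
        split_ifs at hz <;> omega
      · rw [simpleRefl, dif_neg hi, Equiv.Perm.one_apply, Equiv.Perm.one_apply] at hz
        omega

/-- Exchange argument: if `s_i` moves the largest letter up past a letter `a`, the two had already
crossed at some `s_j` further right. Deleting both `s_i` and `s_j` leaves the permutation unchanged
and shortens the word by two. -/
theorem IsReducedWord.descending {n : ℕ} {w : List ℕ} (hw : IsReducedWord n w) :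
    Descending n w := by
  rintro x i z rfl hz
  have hi : 1 ≤ i ∧ i ≤ n := hw.1 i (by simp)
  set I : Fin (n + 1) := ⟨i, by omega⟩ with hI
  set I' : Fin (n + 1) := ⟨i - 1, by omega⟩ with hI'
  have hlast : wordPerm n z (Fin.last n) = I' := Fin.ext hz
  obtain ⟨a, ha⟩ := (wordPerm n z).surjective I
  have hne : a ≠ Fin.last n := by
    rintro rfl
    have := congrArg Fin.val (ha.symm.trans hlast)
    simp only [hI, hI'] at this
    omega
  obtain ⟨p, j, q, rfl, hj1, hjn, hja, hjb⟩ :=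
    exists_crossing (Fin.lt_last_iff_ne_last.2 hne) (z := z) (by
      rw [hlast, ha, Fin.lt_def]; simp only [hI, hI']; omega)
  set J : Fin (n + 1) := ⟨j, by omega⟩
  set J' : Fin (n + 1) := ⟨j - 1, by omega⟩
  have hja : wordPerm n q a = J' := Fin.ext hja
  have hjb : wordPerm n q (Fin.last n) = J := Fin.ext hjb
  have hsj : simpleRefl n j = Equiv.swap J' J := by rw [simpleRefl, dif_pos ⟨hj1, hjn⟩]
  have hsi : simpleRefl n i = Equiv.swap I' I := by rw [simpleRefl, dif_pos hi]
  rw [wordPerm_append, wordPerm_cons, Equiv.Perm.mul_apply, Equiv.Perm.mul_apply, hsj] at ha hlast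
  rw [hja, Equiv.swap_apply_left] at ha
  rw [hjb, Equiv.swap_apply_right] at hlast
  -- The part `p` between the two crossings carries `{j - 1, j}` onto `{i - 1, i}`, so it conjugates
  -- `s_j` into `s_i`.
  have key : simpleRefl n i * wordPerm n p * simpleRefl n j = wordPerm n p := by
    rw [mul_assoc, hsj, Equiv.mul_swap_eq_swap_mul, hlast, ha, hsi, ← mul_assoc,
      Equiv.swap_mul_self, one_mul]
  have := hw.2 (x ++ (p ++ q)) (fun m hm => hw.1 m (by
    simp only [List.mem_append, List.mem_cons] at hm ⊢; tauto)) (by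
    simp only [wordPerm_append, wordPerm_cons]
    rw [← mul_assoc (wordPerm n p), ← mul_assoc (simpleRefl n i), ← mul_assoc (simpleRefl n i), key])
  simp only [List.length_append, List.length_cons] at this
  omega

/-- As the largest letter never moves up, a bound once reached persists. When the letter `m + 1` of
the subword is read, the position is at most `m + 1`, and it drops to `m` if it equals `m + 1`. -/
theorem Descending.lastVal_le {n m : ℕ} {w : List ℕ} (hw : IsWord n w) (h : Descending n w)
    (hm : (List.range' (m + 1) (n - m)).Sublist w) : lastVal n w ≤ m := by
  induction w generalizing m with
  | nil =>
    rw [List.sublist_nil, List.range'_eq_nil_iff] at hm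
    rw [lastVal_nil]; omega
  | cons i w ih =>
    have hi := hw i (by simp)
    have hw' : IsWord n w := fun j hj => hw j (by simp [hj])
    have hq := h [] i w rfl
    have hle := BottSamelson.lastVal_le n w
    rcases Nat.lt_or_ge m n with hmn | hmn
    · have e : n - m = (n - (m + 1)) + 1 := by omega
      rw [lastVal_cons hi]
      rw [e, List.range'_succ] at hm
      cases hm with
      | cons _ hm =>
        have := ih hw' h.of_cons (m := m) (by rwa [e, List.range'_succ])
        split_ifs <;> omega
      | cons_cons _ hm =>
        have := ih hw' h.of_cons (m := m + 1) hm
        split_ifs <;> omega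
    · exact (BottSamelson.lastVal_le n _).trans hmn

theorem IsReducedWord.lastVal_eq_zero {n : ℕ} {w : List ℕ} (hw : IsReducedWord n w)
    (h : (coxeterWord n).Sublist w) : lastVal n w = 0 :=
  Nat.le_zero.1 (hw.descending.lastVal_le hw.1 h)

/-! ### The Coxeter element and the Bruhat order -/

theorem isWord_coxeterWord (n : ℕ) : IsWord n (coxeterWord n) := by
  intro i hi
  rw [coxeterWord, List.mem_range'_1] at hi
  omega

theorem wordPerm_range'_val (n m : ℕ) (hm : m ≤ n) (x : Fin (n + 1)) :
    (wordPerm n (List.range' (m + 1) (n - m)) x : ℕ) =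
      if (x : ℕ) < m then (x : ℕ) else if (x : ℕ) = n then m else x + 1 := by
  induction hm using Nat.decreasingInduction with
  | self =>
    have := x.2
    simp only [Nat.sub_self, List.range'_zero, wordPerm, List.map_nil, List.prod_nil,
      Equiv.Perm.one_apply]
    split_ifs <;> omega
  | of_succ k hk ih =>
    have e : n - k = (n - (k + 1)) + 1 := by omega
    rw [e, List.range'_succ, wordPerm_cons, Equiv.Perm.mul_apply, simpleRefl_apply_val (by omega),
      ih]
    have := x.2
    split_ifs <;> omega

theorem coxeterElt_val (n : ℕ) (x : Fin (n + 1)) :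
    (coxeterElt n x : ℕ) = if (x : ℕ) = n then 0 else (x : ℕ) + 1 := by
  simpa [coxeterElt, coxeterWord] using wordPerm_range'_val n 0 n.zero_le x

theorem lastVal_coxeterWord (n : ℕ) : lastVal n (coxeterWord n) = 0 := by
  have := coxeterElt_val n (Fin.last n)
  rwa [Fin.val_last, if_pos rfl] at this

/-- Any word for `c` sends the largest letter to the bottom, hence contains `s₁ ⋯ sₙ` as a subword
and is at least as long. -/
theorem isReducedWord_coxeterWord (n : ℕ) : IsReducedWord n (coxeterWord n) := by
  refine ⟨isWord_coxeterWord n, fun w hw h => (coxeterWord_sublist hw ?_).length_le⟩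
  rw [lastVal, h]
  exact lastVal_coxeterWord n

theorem coxeterWord_sublist_of_bruhatLE {n : ℕ} {w : List ℕ} (hw : IsReducedWord n w)
    (h : BruhatLE n (coxeterElt n) (wordPerm n w)) : (coxeterWord n).Sublist w := by
  obtain ⟨w', hs, hr, hp⟩ := h w hw rfl
  refine (coxeterWord_sublist hr.1 ?_).trans hs
  rw [lastVal, hp]
  exact lastVal_coxeterWord n

/-- The Bruhat order quantifies over all reduced words. One of them suffices here, because the
subword condition is read off from the image of the largest letter, which depends only on the
permutation. -/
theorem bruhatLE_of_coxeterWord_sublist {n : ℕ} {w : List ℕ} (hw : IsReducedWord n w)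
    (h : (coxeterWord n).Sublist w) : BruhatLE n (coxeterElt n) (wordPerm n w) := by
  intro w' hw' hp
  refine ⟨coxeterWord n, coxeterWord_sublist hw'.1 ?_, isReducedWord_coxeterWord n, rfl⟩
  rw [lastVal, hp]
  exact hw.lastVal_eq_zero h

/-- Extraction of the trajectory of the largest letter, modulo commutation. -/
theorem Descending.exists_commEquiv {n : ℕ} {w : List ℕ} (hw : IsWord n w) (h : Descending n w) :
    ∃ u v : List ℕ, (∀ i ∈ u, lastVal n w + 1 < i) ∧ (∀ i ∈ v, i < n) ∧
      CommEquiv w (u ++ List.range' (lastVal n w + 1) (n - lastVal n w) ++ v) := by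
  induction w with
  | nil => exact ⟨[], [], by simp, by simp, by simpa [lastVal_nil] using CommEquiv.refl _⟩
  | cons i w ih =>
    have hi := hw i (by simp)
    have hq := h [] i w rfl
    have hle := BottSamelson.lastVal_le n w
    obtain ⟨u, v, hu, hv, huv⟩ := ih (fun j hj => hw j (by simp [hj])) h.of_cons
    have hc := huv.append [i] []
    simp only [List.append_nil, List.singleton_append] at hc
    rw [lastVal_cons hi, if_neg hq]
    generalize lastVal n w = q at *
    -- With the largest letter at `q`, the case `i = q + 1` is excluded by `hq`. So `i ≥ q + 2`
    -- joins `u`; `i = q` commutes past `u` and extends the middle word; `i < q` commutes past both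
    -- and joins `v`.
    rcases lt_trichotomy q i with hlt | rfl | hgt
    · rw [if_neg (by omega)]
      refine ⟨i :: u, v, ?_, hv, hc⟩
      rintro j (_ | ⟨_, hj⟩)
      · omega
      · exact hu j hj
    · rw [if_pos rfl]
      refine ⟨u, v, fun j hj => ?_, hv, hc.trans ?_⟩
      · have := hu j hj; omega
      · have e : n - (q - 1) = (n - q) + 1 := by omega
        rw [e, List.range'_succ, Nat.sub_add_cancel hi.1, List.append_assoc, List.append_assoc,
          List.cons_append]
        exact commEquiv_cons_append _ _ _ fun b hb => by have := hu b hb; omega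
    · rw [if_neg (by omega)]
      refine ⟨u, i :: v, hu, ?_, hc.trans ?_⟩
      · rintro j (_ | ⟨_, hj⟩)
        · omega
        · exact hv j hj
      · refine commEquiv_cons_append _ _ _ fun b hb => ?_
        rw [List.mem_append, List.mem_range'_1] at hb
        rcases hb with hb | hb
        · have := hu b hb; omega
        · omega

theorem IsReducedWord.exists_commEquiv {n : ℕ} {w : List ℕ} (hw : IsReducedWord n w)
    (h : (coxeterWord n).Sublist w) : ∃ u v : List ℕ, IsWord n u ∧ 1 ∉ u ∧ IsWord n v ∧ n ∉ v ∧
      CommEquiv w (u ++ coxeterWord n ++ v) := by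
  obtain ⟨u, v, hu, hv, huv⟩ := hw.descending.exists_commEquiv hw.1
  rw [hw.lastVal_eq_zero h] at hu huv
  refine ⟨u, v, fun i hi => hw.1 i ?_, fun h1 => by simpa using hu 1 h1, fun i hi => hw.1 i ?_,
    fun h1 => by simpa using hv n h1, huv⟩
  · exact huv.perm.mem_iff.2 (by simp [hi])
  · exact huv.perm.mem_iff.2 (by simp [hi])

section Subbundles

variable {A : Type u} [CommRing A] {m n : ℕ}

/-! ### Subbundles -/

/-- The splitting needs no hypothesis on the rank, so it is available before the rank of `N` is
known. -/
theorem exists_retraction_of_projective_quotient {N : Submodule A (Fin m → A)}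
    (h : Module.Projective A ((Fin m → A) ⧸ N)) :
    ∃ r : (Fin m → A) →ₗ[A] N, r ∘ₗ N.subtype = LinearMap.id := by
  obtain ⟨s, hs⟩ := Module.projective_lifting_property N.mkQ LinearMap.id N.mkQ_surjective
  have hmem : ∀ x, ((LinearMap.id : (Fin m → A) →ₗ[A] _) - s ∘ₗ N.mkQ) x ∈ N := fun x => by
    rw [← Submodule.Quotient.mk_eq_zero, ← Submodule.mkQ_apply]
    have := LinearMap.congr_fun hs (N.mkQ x)
    simp only [LinearMap.comp_apply, LinearMap.id_apply] at this
    simp only [LinearMap.sub_apply, LinearMap.id_apply, LinearMap.comp_apply, map_sub, this,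
      sub_self]
  refine ⟨LinearMap.codRestrict N _ hmem, LinearMap.ext fun x => Subtype.ext ?_⟩
  have : N.mkQ (x : Fin m → A) = 0 := by simp
  simp [LinearMap.comp_apply, this]

theorem finite_of_projective_quotient {N : Submodule A (Fin m → A)}
    (h : Module.Projective A ((Fin m → A) ⧸ N)) : Module.Finite A N := by
  obtain ⟨r, hr⟩ := exists_retraction_of_projective_quotient h
  exact Module.Finite.of_surjective r fun x => ⟨x, LinearMap.congr_fun hr x⟩

theorem projective_of_projective_quotient {N : Submodule A (Fin m → A)}
    (h : Module.Projective A ((Fin m → A) ⧸ N)) : Module.Projective A N := by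
  obtain ⟨r, hr⟩ := exists_retraction_of_projective_quotient h
  exact Module.Projective.of_split N.subtype r hr

/-- A retraction onto `N` splits `N'` as `N ⊕ K` with `K` finite projective. Comparing ranks, `K`
has rank 0 everywhere, hence vanishes. -/
theorem IsSubbundle.eq_of_le {i : ℕ} {N N' : Submodule A (Fin m → A)} (h : IsSubbundle i N)
    (h' : IsSubbundle i N') (hle : N ≤ N') : N = N' := by
  obtain ⟨r, hr⟩ := h.exists_retraction
  have := finite_of_projective_quotient h.projective_quotient
  have := finite_of_projective_quotient h'.projective_quotient
  have := projective_of_projective_quotient h.projective_quotient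
  have := projective_of_projective_quotient h'.projective_quotient
  have hr' : ∀ x : N, r x = x := LinearMap.congr_fun hr
  let p : N' →ₗ[A] N := r ∘ₗ N'.subtype
  let ι : N →ₗ[A] N' := Submodule.inclusion hle
  have hp : ∀ x, p (ι x) = x := hr'
  let K := LinearMap.ker p
  let d : N' →ₗ[A] K := LinearMap.codRestrict K (LinearMap.id - ι ∘ₗ p) fun x => by
    simp [K, hp]
  have hd : d ∘ₗ K.subtype = LinearMap.id := by
    ext x : 2
    have : p x = 0 := x.2
    simp [d, this]
  have : Module.Finite A K := Module.Finite.of_surjective d fun x => ⟨x, LinearMap.congr_fun hd x⟩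
  have : Module.Projective A K := Module.Projective.of_split K.subtype d hd
  let f : (N × K) →ₗ[A] N' := ι.coprod K.subtype
  have hf : Function.Bijective f := by
    constructor
    · rw [injective_iff_map_eq_zero]
      rintro ⟨x, y⟩ hxy
      have hy : p y = 0 := y.2
      have hxy' : ι x + y = 0 := hxy
      have hx : x = 0 := by simpa [hp, hy] using congrArg p hxy'
      subst hx
      simp only [map_zero, zero_add, ZeroMemClass.coe_eq_zero] at hxy'
      rw [hxy']; rfl
    · intro y
      exact ⟨(p y, d y), by simp [f, d]⟩
  have hK : Module.rankAtStalk (R := A) K = 0 := by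
    ext q
    have h1 := congrFun
      (Module.rankAtStalk_eq_of_equiv (M := N × K) (N := N') (LinearEquiv.ofBijective f hf)) q
    rw [h'.rank_eq, Module.rankAtStalk_prod, Pi.add_apply, h.rank_eq] at h1
    simpa using h1
  rw [Module.rankAtStalk_eq_zero_iff_subsingleton] at hK
  refine le_antisymm hle fun y hy => ?_
  have h0 : (⟨y, hy⟩ : N') - ι (p ⟨y, hy⟩) = 0 := congrArg Subtype.val (Subsingleton.elim (d ⟨y, hy⟩) 0)
  have h1 : y = r y := congrArg Subtype.val (sub_eq_zero.1 h0)
  rw [h1]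
  exact (r y).2

/-! ### The line `⟨e₁⟩` and its complement `⟨e₂, …, e_{n+1}⟩` -/

theorem mem_stdSub {a : ℕ} {x : Fin m → A} :
    x ∈ stdSub A m a ↔ ∀ i : Fin m, a ≤ (i : ℕ) → x i = 0 := by
  constructor
  · intro hx i hi
    have : stdSub A m a ≤ LinearMap.ker (LinearMap.proj i : (Fin m → A) →ₗ[A] A) := by
      refine Submodule.span_le.2 ?_
      rintro _ ⟨j, hj, rfl⟩
      have : i ≠ j := by rintro rfl; omega
      simp [this]
    exact this hx
  · intro hx
    rw [show x = ∑ i, x i • (Pi.single i 1 : Fin m → A) from by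
      ext j; simp [Finset.sum_apply, Pi.single_apply]]
    refine Submodule.sum_mem _ fun i _ => ?_
    by_cases hi : (i : ℕ) < a
    · exact Submodule.smul_mem _ _ (Submodule.subset_span ⟨i, hi, rfl⟩)
    · rw [hx i (by omega), zero_smul]; exact zero_mem _

theorem mem_hyperplane {x : Fin (n + 1) → A} : x ∈ hyperplane A (n + 1) ↔ x 0 = 0 := by
  constructor
  · intro hx
    have : hyperplane A (n + 1) ≤ LinearMap.ker (LinearMap.proj 0 : (Fin (n + 1) → A) →ₗ[A] A) := by
      refine Submodule.span_le.2 ?_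
      rintro _ ⟨j, hj, rfl⟩
      have : 0 ≠ j := by rintro rfl; simp at hj
      simp [this]
    exact this hx
  · intro hx
    rw [show x = ∑ i, x i • (Pi.single i 1 : Fin (n + 1) → A) from by
      ext j; simp [Finset.sum_apply, Pi.single_apply]]
    refine Submodule.sum_mem _ fun i _ => ?_
    by_cases hi : 0 < (i : ℕ)
    · exact Submodule.smul_mem _ _ (Submodule.subset_span ⟨i, hi, rfl⟩)
    · rw [show i = 0 from Fin.ext (by simpa using hi), hx, zero_smul]; exact zero_mem _

theorem stdSub_zero : stdSub A m 0 = ⊥ := by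
  ext x
  rw [mem_stdSub, Submodule.mem_bot]
  exact ⟨fun h => funext fun i => h i (Nat.zero_le _), fun h i _ => h ▸ rfl⟩

theorem stdSub_self : stdSub A m m = ⊤ := by
  ext x
  simp only [mem_stdSub, Submodule.mem_top, iff_true]
  intro i hi
  omega

theorem mem_stdSub_one {x : Fin (n + 1) → A} :
    x ∈ stdSub A (n + 1) 1 ↔ x = Pi.single 0 (x 0) := by
  rw [mem_stdSub]
  constructor
  · intro h
    ext i
    by_cases hi : i = 0
    · subst hi; simp
    · rw [Pi.single_eq_of_ne hi, h i (Nat.one_le_iff_ne_zero.2 fun h => hi (Fin.ext h))]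
  · intro h i hi
    rw [h, Pi.single_eq_of_ne]
    rintro rfl
    simp at hi

theorem single_zero_mem_stdSub_one (a : A) :
    (Pi.single 0 a : Fin (n + 1) → A) ∈ stdSub A (n + 1) 1 := by
  rw [mem_stdSub_one, Pi.single_eq_same]

theorem isCompl_line_hyperplane : IsCompl (stdSub A (n + 1) 1) (hyperplane A (n + 1)) := by
  constructor
  · rw [Submodule.disjoint_def]
    intro x hx hx'
    rw [mem_stdSub_one] at hx
    rw [hx, mem_hyperplane.1 hx', Pi.single_zero]
  · rw [codisjoint_iff, eq_top_iff]
    intro x _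
    rw [← add_sub_cancel (Pi.single 0 (x 0)) x]
    refine Submodule.add_mem_sup (single_zero_mem_stdSub_one _) (mem_hyperplane.2 ?_)
    simp

/-- By the modular law; with `sup_inf_hyperplane` this makes submodules containing `e₁` correspond
to submodules of the hyperplane. -/
theorem line_sup_inf {N : Submodule A (Fin (n + 1) → A)} (h : stdSub A (n + 1) 1 ≤ N) :
    stdSub A (n + 1) 1 ⊔ N ⊓ hyperplane A (n + 1) = N := by
  rw [inf_comm, ← sup_inf_assoc_of_le _ h, isCompl_line_hyperplane.sup_eq_top, top_inf_eq]

theorem sup_inf_hyperplane {N : Submodule A (Fin (n + 1) → A)} (h : N ≤ hyperplane A (n + 1)) :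
    (stdSub A (n + 1) 1 ⊔ N) ⊓ hyperplane A (n + 1) = N := by
  rw [sup_comm, sup_inf_assoc_of_le _ h, isCompl_line_hyperplane.inf_eq_bot, sup_bot_eq]

/-- The projection onto `⟨e₂, …, e_{n+1}⟩` along `e₁`. -/
def projHyperplane (A : Type u) [CommRing A] (n : ℕ) : (Fin (n + 1) → A) →ₗ[A] (Fin (n + 1) → A) :=
  LinearMap.id - LinearMap.single A (fun _ => A) 0 ∘ₗ LinearMap.proj 0

theorem projHyperplane_apply (x : Fin (n + 1) → A) :
    projHyperplane A n x = x - Pi.single 0 (x 0) := rfl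

theorem mem_sup_iff {N : Submodule A (Fin (n + 1) → A)} (h : N ≤ hyperplane A (n + 1))
    (x : Fin (n + 1) → A) : x ∈ stdSub A (n + 1) 1 ⊔ N ↔ projHyperplane A n x ∈ N := by
  rw [projHyperplane_apply]
  constructor
  · intro hx
    obtain ⟨y, hy, z, hz, rfl⟩ := Submodule.mem_sup.1 hx
    have h0 : z 0 = 0 := mem_hyperplane.1 (h hz)
    rw [mem_stdSub_one] at hy
    rwa [Pi.add_apply, h0, add_zero, ← hy, add_sub_cancel_left]
  · intro hx
    rw [← add_sub_cancel (Pi.single 0 (x 0)) x]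
    exact Submodule.add_mem_sup (single_zero_mem_stdSub_one _) hx

/-- Splitting off the coordinate along `e₁`, which vanishes on `N`, identifies `A^{n+1}/N` with `A ⊕
A^{n+1}/(⟨e₁⟩ + N)`. Each quotient is thus a retract of a module that is projective as soon as the
other one is. -/
theorem projective_quotient_sup_iff {N : Submodule A (Fin (n + 1) → A)}
    (h : N ≤ hyperplane A (n + 1)) :
    Module.Projective A ((Fin (n + 1) → A) ⧸ (stdSub A (n + 1) 1 ⊔ N)) ↔
      Module.Projective A ((Fin (n + 1) → A) ⧸ N) := by
  let f : ((Fin (n + 1) → A) ⧸ (stdSub A (n + 1) 1 ⊔ N)) →ₗ[A] ((Fin (n + 1) → A) ⧸ N) :=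
    Submodule.mapQ _ _ (projHyperplane A n) fun x hx => (mem_sup_iff h x).1 hx
  let g : ((Fin (n + 1) → A) ⧸ N) →ₗ[A] ((Fin (n + 1) → A) ⧸ (stdSub A (n + 1) 1 ⊔ N)) :=
    Submodule.mapQ _ _ LinearMap.id le_sup_right
  constructor
  · intro hp
    let p : ((Fin (n + 1) → A) ⧸ N) →ₗ[A] A := Submodule.liftQ _ (LinearMap.proj 0)
      fun x hx => mem_hyperplane.1 (h hx)
    refine Module.Projective.of_split
      (M := A × ((Fin (n + 1) → A) ⧸ (stdSub A (n + 1) 1 ⊔ N))) (p.prod g)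
      ((N.mkQ ∘ₗ LinearMap.single A (fun _ => A) 0).coprod f) ?_
    ext : 1
    refine LinearMap.ext fun x => ?_
    change N.mkQ (Pi.single 0 (x 0)) + N.mkQ (projHyperplane A n x) = N.mkQ x
    rw [← map_add, projHyperplane_apply, add_sub_cancel]
  · intro hp
    refine Module.Projective.of_split f g ?_
    ext : 1
    refine LinearMap.ext fun x => ?_
    change (stdSub A (n + 1) 1 ⊔ N).mkQ (projHyperplane A n x) = (stdSub A (n + 1) 1 ⊔ N).mkQ x
    rw [← sub_eq_zero, ← map_sub, Submodule.mkQ_apply, Submodule.Quotient.mk_eq_zero,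
      projHyperplane_apply, sub_sub_cancel_left]
    exact neg_mem (Submodule.mem_sup_left (single_zero_mem_stdSub_one _))

/-- The sum `⟨e₁⟩ + N` is direct, so its rank is one more than that of `N`. This is the index shift
behind `c⁻¹(u)`. -/
theorem isSubbundle_sup_iff {i : ℕ} {N : Submodule A (Fin (n + 1) → A)}
    (h : N ≤ hyperplane A (n + 1)) :
    IsSubbundle (i + 1) (stdSub A (n + 1) 1 ⊔ N) ↔ IsSubbundle i N := by
  have key : Module.Projective A ((Fin (n + 1) → A) ⧸ N) → ∀ q : PrimeSpectrum A,
      Module.rankAtStalk (stdSub A (n + 1) 1 ⊔ N : Submodule A (Fin (n + 1) → A)) q =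
        Module.rankAtStalk N q + 1 := by
    intro hp q
    have := finite_of_projective_quotient hp
    have := projective_of_projective_quotient hp
    have : Nontrivial A := q.nontrivial
    let f : (A × N) →ₗ[A] (stdSub A (n + 1) 1 ⊔ N : Submodule A (Fin (n + 1) → A)) :=
      LinearMap.codRestrict _ ((LinearMap.single A (fun _ => A) 0).coprod N.subtype) fun x =>
        Submodule.add_mem_sup (single_zero_mem_stdSub_one x.1) x.2.2
    have hf : Function.Bijective f := by
      constructor
      · rw [injective_iff_map_eq_zero]
        rintro ⟨a, y⟩ hxy
        have hy : (y : Fin (n + 1) → A) 0 = 0 := mem_hyperplane.1 (h y.2)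
        have h1 : Pi.single 0 a + (y : Fin (n + 1) → A) = 0 := congrArg Subtype.val hxy
        have ha : a = 0 := by simpa [hy] using congrFun h1 0
        subst ha
        rw [Pi.single_zero, zero_add, ZeroMemClass.coe_eq_zero] at h1
        rw [h1]; rfl
      · rintro ⟨x, hx⟩
        refine ⟨(x 0, ⟨projHyperplane A n x, (mem_sup_iff h x).1 hx⟩), Subtype.ext ?_⟩
        change Pi.single 0 (x 0) + projHyperplane A n x = x
        rw [projHyperplane_apply, add_sub_cancel]
    rw [← Module.rankAtStalk_eq_of_equiv (M := A × N) (LinearEquiv.ofBijective f hf),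
      Module.rankAtStalk_prod, Pi.add_apply, Module.rankAtStalk_self, Pi.one_apply, add_comm]
  constructor
  · intro hs
    have hp := (projective_quotient_sup_iff h).1 hs.projective_quotient
    exact ⟨hp, fun q => by have := key hp q; rw [hs.rank_eq] at this; omega⟩
  · intro hs
    exact ⟨(projective_quotient_sup_iff h).2 hs.projective_quotient, fun q => by
      rw [key hs.projective_quotient q, hs.rank_eq]⟩

/-! ### The rotated standard flag -/

theorem mem_permSub {σ : Equiv.Perm (Fin m)} {N : Submodule A (Fin m → A)} {x : Fin m → A} :
    x ∈ permSub σ N ↔ (fun i => x (σ i)) ∈ N := by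
  rw [permSub, Submodule.mem_map]
  constructor
  · rintro ⟨y, hy, rfl⟩
    convert hy using 1
    ext i
    simp [permEquiv, LinearMap.funLeft_apply]
  · intro h
    refine ⟨_, h, ?_⟩
    ext i
    simp [permEquiv, LinearMap.funLeft_apply]

/-- For `a ≤ n` the rotation does not wrap around: `c(E_a) = ⟨e₂, …, e_{a+1}⟩`, with coordinates
numbered from 0. -/
theorem mem_rotated_stdSub {a : ℕ} (ha : a ≤ n) {x : Fin (n + 1) → A} :
    x ∈ permSub (coxeterElt n) (stdSub A (n + 1) a) ↔
      x 0 = 0 ∧ ∀ i : Fin (n + 1), a < (i : ℕ) → x i = 0 := by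
  rw [mem_permSub, mem_stdSub]
  constructor
  · intro h
    constructor
    · have := h (Fin.last n) (by simpa using ha)
      rwa [show coxeterElt n (Fin.last n) = 0 from Fin.ext (by simp [coxeterElt_val])] at this
    · intro i hi
      have := h ⟨i - 1, by omega⟩ (by simp only; omega)
      rwa [show coxeterElt n ⟨i - 1, _⟩ = i from
        Fin.ext (by rw [coxeterElt_val]; simp only; split_ifs <;> omega)] at this
  · rintro ⟨h0, h⟩ i hi
    by_cases hin : (i : ℕ) = n
    · rwa [show coxeterElt n i = 0 from Fin.ext (by simp [coxeterElt_val, hin])]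
    · exact h _ (by rw [coxeterElt_val, if_neg hin]; omega)

theorem line_sup_rotated_stdSub {a : ℕ} (ha : a ≤ n) :
    stdSub A (n + 1) 1 ⊔ permSub (coxeterElt n) (stdSub A (n + 1) a) = stdSub A (n + 1) (a + 1) := by
  ext x
  rw [mem_sup_iff fun y hy => mem_hyperplane.2 ((mem_rotated_stdSub ha).1 hy).1,
    mem_rotated_stdSub ha, mem_stdSub, projHyperplane_apply]
  constructor
  · intro h i hi
    have := h.2 i hi
    rwa [Pi.sub_apply, Pi.single_eq_of_ne, sub_zero] at this
    rintro rfl; simp at hi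
  · intro h
    refine ⟨by simp, fun i hi => ?_⟩
    rw [Pi.sub_apply, h i hi, Pi.single_eq_of_ne, sub_zero]
    rintro rfl; simp at hi

theorem rotated_stdSub_last :
    permSub (coxeterElt n) (stdSub A (n + 1) n) = hyperplane A (n + 1) := by
  ext x
  rw [mem_rotated_stdSub le_rfl, mem_hyperplane]
  exact ⟨fun h => h.1, fun h => ⟨h, fun i hi => by omega⟩⟩

end Subbundles

section Galleries

variable {A : Type u} [CommRing A] {m n : ℕ}

/-! ### Galleries

A point of the Bott--Samelson variety of a word is a sequence of modifications of a flag, one for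
each letter of the word. The current flag is recorded by its members, indexed by `ℕ`. -/

/-- `l` is a gallery of type `w` starting at the flag `S`: reading the letter `i` replaces the
`i`-th member of the current flag. -/
inductive IsGallery : (ℕ → Submodule A (Fin m → A)) → List ℕ → List (Submodule A (Fin m → A)) → Prop
  | nil (S) : IsGallery S [] []
  | cons {S i w V l} (h : IsSubbundle i V) (hl : S (i - 1) ≤ V) (hr : V ≤ S (i + 1))
      (h' : IsGallery (Function.update S i V) w l) : IsGallery S (i :: w) (V :: l)

/-- The flag at the end of a gallery. -/
def endFlag {α : Type*} : (ℕ → α) → List ℕ → List α → ℕ → α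
  | S, i :: w, V :: l => endFlag (Function.update S i V) w l
  | S, [], _ => S
  | S, _ :: _, [] => S

theorem isGallery_nil {S : ℕ → Submodule A (Fin m → A)} {l} : IsGallery S [] l ↔ l = [] :=
  ⟨fun h => by cases h; rfl, fun h => h ▸ .nil S⟩

theorem isGallery_cons {S : ℕ → Submodule A (Fin m → A)} {i w V l} :
    IsGallery S (i :: w) (V :: l) ↔ IsSubbundle i V ∧ S (i - 1) ≤ V ∧ V ≤ S (i + 1) ∧
      IsGallery (Function.update S i V) w l :=
  ⟨fun h => by cases h with | cons h hl hr h' => exact ⟨h, hl, hr, h'⟩,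
    fun h => .cons h.1 h.2.1 h.2.2.1 h.2.2.2⟩

theorem IsGallery.length_eq {S : ℕ → Submodule A (Fin m → A)} {w l} (h : IsGallery S w l) :
    l.length = w.length := by
  induction h with
  | nil => rfl
  | cons _ _ _ _ ih => simp [ih]

theorem endFlag_append {α : Type*} (S : ℕ → α) {w w' : List ℕ} {l l' : List α}
    (h : l.length = w.length) :
    endFlag S (w ++ w') (l ++ l') = endFlag (endFlag S w l) w' l' := by
  induction w generalizing S l with
  | nil => rw [List.length_nil, List.length_eq_zero_iff] at h; subst h; rfl
  | cons i w ih =>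
    cases l with
    | nil => simp at h
    | cons V l => exact ih _ (by simpa using h)

theorem isGallery_append {S : ℕ → Submodule A (Fin m → A)} {w w' l l'}
    (h : l.length = w.length) : IsGallery S (w ++ w') (l ++ l') ↔
      IsGallery S w l ∧ IsGallery (endFlag S w l) w' l' := by
  induction w generalizing S l with
  | nil =>
    rw [List.length_nil, List.length_eq_zero_iff] at h; subst h
    simp [isGallery_nil, endFlag]
  | cons i w ih =>
    cases l with
    | nil => simp at h
    | cons V l =>
      simp only [List.cons_append, isGallery_cons, ih (l := l) (by simpa using h), endFlag,
        and_assoc]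

theorem IsGallery.exists_append {S : ℕ → Submodule A (Fin m → A)} {w w' l}
    (h : IsGallery S (w ++ w') l) : ∃ l₁ l₂, l = l₁ ++ l₂ ∧ IsGallery S w l₁ ∧
      IsGallery (endFlag S w l₁) w' l₂ := by
  have hl : (l.take w.length).length = w.length := by
    rw [List.length_take, h.length_eq, List.length_append]; omega
  refine ⟨l.take w.length, l.drop w.length, (List.take_append_drop _ _).symm, ?_⟩
  rwa [← isGallery_append hl, List.take_append_drop]

theorem endFlag_map {α β : Type*} (g : α → β) (S : ℕ → α) (w : List ℕ) (l : List α) (a : ℕ) :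
    endFlag (fun b => g (S b)) w (l.map g) a = g (endFlag S w l a) := by
  induction w generalizing S l with
  | nil => rfl
  | cons i w ih =>
    cases l with
    | nil => rfl
    | cons V l =>
      rw [List.map_cons, endFlag, endFlag, ← ih]
      congr 1
      ext b
      by_cases hb : b = i <;> simp [hb]

theorem endFlag_of_notMem {α : Type*} {S : ℕ → α} {w : List ℕ} {l : List α} {a : ℕ}
    (ha : a ∉ w) : endFlag S w l a = S a := by
  induction w generalizing S l with
  | nil => rfl
  | cons i w ih =>
    rw [List.mem_cons, not_or] at ha
    cases l with
    | nil => rfl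
    | cons V l => rw [endFlag, ih ha.2, Function.update_of_ne ha.1]

theorem IsGallery.permSub {S : ℕ → Submodule A (Fin m → A)} {w l} (h : IsGallery S w l)
    (σ : Equiv.Perm (Fin m)) :
    IsGallery (fun a => BottSamelson.permSub σ (S a)) w (l.map (BottSamelson.permSub σ)) := by
  induction h with
  | nil => exact .nil _
  | @cons S i w V l h hl hr h' ih =>
    refine .cons (h.permSub σ) (permSub_mono σ hl) (permSub_mono σ hr) ?_
    convert ih using 1
    ext b : 1
    by_cases hb : b = i <;> simp [hb]

/-- Only the members of the flag of index at most `n + 1` matter. -/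
theorem isGallery_congr {S S' : ℕ → Submodule A (Fin m → A)} (h : ∀ a ≤ n + 1, S a = S' a)
    {w : List ℕ} (hw : IsWord n w) {l} : (IsGallery S w l ↔ IsGallery S' w l) ∧
      ∀ a ≤ n + 1, endFlag S w l a = endFlag S' w l a := by
  induction w generalizing S S' l with
  | nil => exact ⟨by simp only [isGallery_nil], h⟩
  | cons i w ih =>
    have hi := hw i (by simp)
    cases l with
    | nil => exact ⟨⟨fun h => (by cases h), fun h => (by cases h)⟩, h⟩
    | cons V l =>
      have hu : ∀ a ≤ n + 1, Function.update S i V a = Function.update S' i V a := fun a ha => by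
        simp only [Function.update_apply, h a ha]
      have ih' := ih hu (fun j hj => hw j (by simp [hj])) (l := l)
      rw [isGallery_cons, isGallery_cons, h _ (by omega), h _ (by omega), ih'.1]
      exact ⟨Iff.rfl, ih'.2⟩

/-- If `e₁` is missing from the `a`-th member of the final flag, then the word contains the subword
`s₁ ⋯ s_a`. -/
theorem IsGallery.range'_sublist {w : List ℕ} {l} (h : IsGallery (stdSub A (n + 1)) w l) {a : ℕ}
    (ha : Pi.single 0 1 ∉ endFlag (stdSub A (n + 1)) w l a) : (List.range' 1 a).Sublist w := by
  induction w using List.reverseRecOn generalizing l a with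
  | nil =>
    cases a with
    | zero => simp
    | succ a =>
      refine absurd (mem_stdSub.2 fun i hi => ?_) ha
      rw [Pi.single_eq_of_ne]
      rintro rfl
      simp at hi
  | append_singleton w i ih =>
    obtain ⟨l₁, l₂, rfl, h₁, h₂⟩ := h.exists_append
    obtain ⟨V, rfl⟩ := List.length_eq_one_iff.1 h₂.length_eq
    rw [isGallery_cons] at h₂
    rw [endFlag_append _ h₁.length_eq, endFlag, endFlag] at ha
    by_cases hai : a = i
    · subst hai
      rw [Function.update_self] at ha
      cases a with
      | zero => simp
      | succ a =>
        -- The new member contains its left neighbour, which therefore misses `e₁` as well; the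
        -- final letter extends the subword found for that neighbour.
        have := ih h₁ fun hmem => ha (h₂.2.1 hmem)
        rw [List.range'_1_concat, Nat.add_comm 1 a]
        exact this.append (List.Sublist.refl _)
    · rw [Function.update_of_ne hai] at ha
      exact (ih h₁ ha).trans (List.sublist_append_left _ _)

/-! ### Flags containing `⟨e₁⟩` and flags through `⟨e₂, …, e_{n+1}⟩` -/

/-- `T` is a complete flag through the hyperplane `⟨e₂, …, e_{n+1}⟩`. -/
structure IsHyperplaneFlag (n : ℕ) (T : ℕ → Submodule A (Fin (n + 1) → A)) : Prop where
  le_hyperplane : ∀ a ≤ n, T a ≤ hyperplane A (n + 1)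
  last : T n = hyperplane A (n + 1)
  top : T (n + 1) = ⊤
  isSubbundle : ∀ a ≤ n, IsSubbundle a (T a)
  le_succ : ∀ a < n, T a ≤ T (a + 1)

/-- The members of `S` are obtained from those of `T` by adding the line `⟨e₁⟩`. -/
structure IsLift (n : ℕ) (S T : ℕ → Submodule A (Fin (n + 1) → A)) : Prop where
  zero : S 0 = T 0
  succ : ∀ a ≤ n, S (a + 1) = stdSub A (n + 1) 1 ⊔ T a

theorem IsHyperplaneFlag.update {T : ℕ → Submodule A (Fin (n + 1) → A)} (hT : IsHyperplaneFlag n T)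
    {b : ℕ} (hbn : b < n) {H} (hH : IsSubbundle b H) (hl : T (b - 1) ≤ H)
    (hr : H ≤ T (b + 1)) : IsHyperplaneFlag n (Function.update T b H) where
  le_hyperplane a ha := by
    by_cases h : a = b
    · subst h; simpa using hr.trans (hT.le_hyperplane _ hbn)
    · simpa [h] using hT.le_hyperplane a ha
  last := by rw [Function.update_of_ne (by omega), hT.last]
  top := by rw [Function.update_of_ne (by omega), hT.top]
  isSubbundle a ha := by
    by_cases h : a = b
    · subst h; simpa using hH
    · simpa [h] using hT.isSubbundle a ha
  le_succ a ha := by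
    by_cases h : a = b
    · subst h; simpa using hr
    · by_cases h' : a + 1 = b
      · subst h'; simpa using hl
      · simpa [h, h'] using hT.le_succ a ha

theorem IsLift.update {S T : ℕ → Submodule A (Fin (n + 1) → A)} (h : IsLift n S T) {b : ℕ}
    (hb : 1 ≤ b) (H) :
    IsLift n (Function.update S (b + 1) (stdSub A (n + 1) 1 ⊔ H)) (Function.update T b H) where
  zero := by
    rw [Function.update_of_ne (by omega), Function.update_of_ne (by omega), h.zero]
  succ a ha := by
    by_cases hab : a = b
    · subst hab; simp
    · simpa [hab] using h.succ a ha

/-- Letters below `n` never replace the `n`-th member, so everything inserted stays inside the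
hyperplane. -/
theorem IsHyperplaneFlag.gallery_le {T : ℕ → Submodule A (Fin (n + 1) → A)}
    (hT : IsHyperplaneFlag n T) {w : List ℕ} (hw : ∀ i ∈ w, i < n) {l} (h : IsGallery T w l) :
    (∀ H ∈ l, H ≤ hyperplane A (n + 1)) ∧ IsHyperplaneFlag n (endFlag T w l) := by
  induction h with
  | nil => exact ⟨by simp, hT⟩
  | @cons T i w V l h hl hr h' ih =>
    have hi := hw i (by simp)
    have := ih (hT.update hi h hl hr) fun j hj => hw j (by simp [hj])
    refine ⟨?_, this.2⟩
    rintro H (_ | ⟨_, hH⟩)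
    · exact hr.trans (hT.le_hyperplane _ hi)
    · exact this.1 H hH

/-- Adding `⟨e₁⟩` preserves inclusions and raises the rank by one, so replacing member `b` below
becomes replacing member `b + 1` above. -/
theorem IsGallery.lift {S T : ℕ → Submodule A (Fin (n + 1) → A)} (hT : IsHyperplaneFlag n T)
    (hST : IsLift n S T) {u : List ℕ} (hu : ∀ i ∈ u, 2 ≤ i ∧ i ≤ n) {l}
    (h : IsGallery T (shiftWord u) l) :
    IsGallery S u (l.map (stdSub A (n + 1) 1 ⊔ ·)) ∧
      IsLift n (endFlag S u (l.map (stdSub A (n + 1) 1 ⊔ ·))) (endFlag T (shiftWord u) l) := by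
  induction u generalizing S T l with
  | nil =>
    obtain rfl := isGallery_nil.1 h
    exact ⟨.nil _, hST⟩
  | cons i u ih =>
    cases l with
    | nil => cases h
    | cons H l =>
      obtain ⟨b, rfl⟩ : ∃ b, i = b + 1 := ⟨i - 1, by have := hu i (by simp); omega⟩
      have hb := hu (b + 1) (by simp)
      change IsGallery T (b :: shiftWord u) (H :: l) at h
      obtain ⟨hs, hl, hr, h'⟩ := isGallery_cons.1 h
      have hH : H ≤ hyperplane A (n + 1) := hr.trans (hT.le_hyperplane _ (by omega))
      have ih' := ih (hT.update (by omega) hs hl hr) (hST.update (by omega) H)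
        (fun j hj => hu j (by simp [hj])) h'
      refine ⟨.cons ((isSubbundle_sup_iff hH).2 hs) ?_ ?_ ih'.1, ih'.2⟩
      · have := hST.succ (b - 1) (by omega)
        rw [Nat.sub_add_cancel (by omega)] at this
        rw [Nat.add_sub_cancel, this]
        exact sup_le_sup_left hl _
      · rw [hST.succ (b + 1) (by omega)]
        exact sup_le_sup_left hr _

/-- Since letters are at least 2, every inserted member contains the line `⟨e₁⟩`, and its
intersection with the hyperplane gives the preimage. -/
theorem IsGallery.exists_lift {S T : ℕ → Submodule A (Fin (n + 1) → A)} (hT : IsHyperplaneFlag n T)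
    (hST : IsLift n S T) {u : List ℕ} (hu : ∀ i ∈ u, 2 ≤ i ∧ i ≤ n) {l} (h : IsGallery S u l) :
    ∃ l', IsGallery T (shiftWord u) l' ∧ l = l'.map (stdSub A (n + 1) 1 ⊔ ·) := by
  induction u generalizing S T l with
  | nil => exact ⟨[], .nil _, isGallery_nil.1 h⟩
  | cons i u ih =>
    cases l with
    | nil => cases h
    | cons V l =>
      obtain ⟨b, rfl⟩ : ∃ b, i = b + 1 := ⟨i - 1, by have := hu i (by simp); omega⟩
      have hb := hu (b + 1) (by simp)
      obtain ⟨hs, hl, hr, h'⟩ := isGallery_cons.1 h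
      have h1 := hST.succ (b - 1) (by omega)
      rw [Nat.sub_add_cancel (by omega)] at h1
      rw [Nat.add_sub_cancel, h1] at hl
      rw [hST.succ (b + 1) (by omega)] at hr
      have hV := line_sup_inf (le_sup_left.trans hl)
      set H := V ⊓ hyperplane A (n + 1)
      have hs' : IsSubbundle b H := (isSubbundle_sup_iff inf_le_right).1 (hV.symm ▸ hs)
      have hl' : T (b - 1) ≤ H :=
        le_inf (le_sup_right.trans hl) (hT.le_hyperplane _ (by omega))
      have hr' : H ≤ T (b + 1) := by
        rw [← sup_inf_hyperplane (hT.le_hyperplane (b + 1) (by omega))]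
        exact inf_le_inf_right _ hr
      rw [← hV] at h'
      obtain ⟨l', hl₁, rfl⟩ := ih (hT.update (by omega) hs' hl' hr') (hST.update (by omega) H)
        (fun j hj => hu j (by simp [hj])) h'
      refine ⟨H :: l', .cons hs' hl' hr' hl₁, ?_⟩
      rw [List.map_cons, hV]

/-- The flags met between a flag `S` containing `⟨e₁⟩` and the corresponding flag `T` through
`⟨e₂, …, e_{n+1}⟩`, when the first `a` members have been replaced. -/
structure IsMixed (n a : ℕ) (S T : ℕ → Submodule A (Fin (n + 1) → A)) : Prop where
  of_le : ∀ b ≤ a, S b = T b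
  succ : ∀ b ≤ n, a ≤ b → S (b + 1) = stdSub A (n + 1) 1 ⊔ T b

theorem IsMixed.update {a : ℕ} {S T : ℕ → Submodule A (Fin (n + 1) → A)} (h : IsMixed n a S T) :
    IsMixed n (a + 1) (Function.update S (a + 1) (T (a + 1))) T where
  of_le b hb := by
    by_cases hba : b = a + 1
    · subst hba; simp
    · rw [Function.update_of_ne hba, h.of_le b (by omega)]
  succ b hb hab := by
    rw [Function.update_of_ne (by omega), h.succ b hb (by omega)]

/-- The members of `T` can be inserted in increasing order: `T (a + 1)` contains `T a`, already in
place, and lies in the next member `⟨e₁⟩ + T (a + 1)`, not yet replaced. -/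
theorem IsMixed.isGallery {S T : ℕ → Submodule A (Fin (n + 1) → A)} (hT : IsHyperplaneFlag n T)
    {a : ℕ} (ha : a ≤ n) (h : IsMixed n a S T) :
    IsGallery S (List.range' (a + 1) (n - a)) ((List.range' (a + 1) (n - a)).map T) ∧
      ∀ b ≤ n + 1, endFlag S (List.range' (a + 1) (n - a))
        ((List.range' (a + 1) (n - a)).map T) b = T b := by
  induction ha using Nat.decreasingInduction generalizing S with
  | self =>
    rw [Nat.sub_self]
    refine ⟨.nil _, fun b hb => ?_⟩
    rcases Nat.lt_or_ge n b with hnb | hnb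
    · obtain rfl : b = n + 1 := by omega
      -- The member of index `n + 1` is never replaced; on both sides it is the whole module.
      exact (h.succ n le_rfl le_rfl).trans
        (by rw [hT.last, hT.top, isCompl_line_hyperplane.sup_eq_top])
    · exact h.of_le b hnb
  | of_succ a ha ih =>
    have e : n - a = (n - (a + 1)) + 1 := by omega
    rw [e, List.range'_succ, List.map_cons]
    have ih' := ih h.update
    refine ⟨.cons (hT.isSubbundle _ ha) ?_ ?_ ih'.1, ih'.2⟩
    · rw [Nat.add_sub_cancel, h.of_le a le_rfl]
      exact hT.le_succ a ha
    · rw [h.succ (a + 1) ha (by omega)]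
      exact le_sup_right

/-- Along consecutive increasing letters each new member contains the one just inserted, so the
chain ends in the last member. -/
theorem IsGallery.le_endFlag {S : ℕ → Submodule A (Fin m → A)} {a c : ℕ} {l}
    (h : IsGallery S (List.range' (a + 1) c) l) :
    S a ≤ endFlag S (List.range' (a + 1) c) l (a + c) := by
  induction c generalizing S a l with
  | zero => rfl
  | succ c ih =>
    rw [List.range'_succ] at h ⊢
    cases l with
    | nil => cases h
    | cons V l =>
      obtain ⟨-, hl, -, h'⟩ := isGallery_cons.1 h
      have := ih h'
      rw [Function.update_self] at this
      rw [Nat.add_sub_cancel] at hl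
      rw [endFlag, show a + (c + 1) = a + 1 + c by omega]
      exact hl.trans this

/-- The inserted members increase up to the hyperplane, so each lies in the intersection of the
hyperplane with `⟨e₁⟩ + T (a + 1)`, which is `T (a + 1)`; equal ranks force equality. -/
theorem IsMixed.eq_of_isGallery {S T : ℕ → Submodule A (Fin (n + 1) → A)}
    (hT : IsHyperplaneFlag n T) {a : ℕ} (ha : a ≤ n) (h : IsMixed n a S T) {l}
    (hl : IsGallery S (List.range' (a + 1) (n - a)) l)
    (hn : endFlag S (List.range' (a + 1) (n - a)) l n = hyperplane A (n + 1)) :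
    l = (List.range' (a + 1) (n - a)).map T := by
  induction ha using Nat.decreasingInduction generalizing S l with
  | self =>
    rw [Nat.sub_self] at hl ⊢
    exact isGallery_nil.1 hl
  | of_succ a ha ih =>
    have e : n - a = (n - (a + 1)) + 1 := by omega
    rw [e, List.range'_succ] at hl hn ⊢
    cases l with
    | nil => cases hl
    | cons V l =>
      obtain ⟨hs, -, hr, h'⟩ := isGallery_cons.1 hl
      have hle := h'.le_endFlag
      rw [Function.update_self, show a + 1 + (n - (a + 1)) = n by omega] at hle
      rw [endFlag] at hn
      rw [hn] at hle
      rw [h.succ (a + 1) ha (by omega)] at hr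
      have hVT : V ≤ T (a + 1) := by
        rw [← sup_inf_hyperplane (hT.le_hyperplane (a + 1) ha)]
        exact le_inf hr hle
      obtain rfl := hs.eq_of_le (hT.isSubbundle _ ha) hVT
      rw [ih h.update h' hn, List.map_cons]

/-- The gallery of type `u c v` in the fibre over `⟨e₂, …, e_{n+1}⟩` attached to a gallery of type
`c⁻¹(u) v` starting at `T`. -/
def expandGallery (n : ℕ) (u : List ℕ) (T : ℕ → Submodule A (Fin (n + 1) → A))
    (l : List (Submodule A (Fin (n + 1) → A))) : List (Submodule A (Fin (n + 1) → A)) :=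
  (l.take u.length).map (stdSub A (n + 1) 1 ⊔ ·) ++
    (coxeterWord n).map (endFlag T (shiftWord u) (l.take u.length)) ++ l.drop u.length

/-! ### Galleries of type `u c v` ending over the hyperplane, and galleries of type `c⁻¹(u) v` -/

section Expand

variable {S T : ℕ → Submodule A (Fin (n + 1) → A)} (hT : IsHyperplaneFlag n T)
  (hST : IsLift n S T) {u v : List ℕ} (hu : ∀ i ∈ u, 2 ≤ i ∧ i ≤ n) (hv : ∀ i ∈ v, 1 ≤ i ∧ i < n)

theorem IsLift.isMixed (hST : IsLift n S T) : IsMixed n 0 S T where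
  of_le b hb := by rw [Nat.le_zero.1 hb, hST.zero]
  succ b hb _ := hST.succ b hb

theorem expandGallery_append {l₁ l₂ : List (Submodule A (Fin (n + 1) → A))}
    (h : l₁.length = u.length) : expandGallery n u T (l₁ ++ l₂) =
      (l₁.map (stdSub A (n + 1) 1 ⊔ ·) ++
        (coxeterWord n).map (endFlag T (shiftWord u) l₁)) ++ l₂ := by
  rw [expandGallery, ← h, List.take_left, List.drop_left]

include hT hST hu hv in
theorem IsGallery.expand {l} (h : IsGallery T (shiftWord u ++ v) l) :
    IsGallery S (u ++ coxeterWord n ++ v) (expandGallery n u T l) ∧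
      ∀ a ≤ n + 1, endFlag S (u ++ coxeterWord n ++ v) (expandGallery n u T l) a =
        endFlag T (shiftWord u ++ v) l a := by
  obtain ⟨l₁, l₂, rfl, h₁, h₂⟩ := h.exists_append
  have hlen : l₁.length = u.length := by rw [h₁.length_eq, shiftWord, List.length_map]
  have hT' := (hT.gallery_le (by
    intro i hi
    obtain ⟨j, hj, rfl⟩ := List.mem_map.1 hi
    have := hu j hj; omega) h₁).2
  obtain ⟨h₃, h₄⟩ := h₁.lift hT hST hu
  obtain ⟨h₅, h₆⟩ := h₄.isMixed.isGallery hT' n.zero_le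
  have hlen' : (l₁.map (stdSub A (n + 1) 1 ⊔ ·)).length = u.length := by simpa using hlen
  have hlen'' : (l₁.map (stdSub A (n + 1) 1 ⊔ ·) ++
        (coxeterWord n).map (endFlag T (shiftWord u) l₁)).length =
      (u ++ coxeterWord n).length := by simp [hlen]
  -- The flags on the two sides are known to agree only up to index `n + 1`, which is all that `v`
  -- can see.
  have hcongr := isGallery_congr h₆ (w := v) (fun i hi => by have := hv i hi; omega) (l := l₂)
  rw [expandGallery_append hlen, isGallery_append hlen'', isGallery_append hlen',
    endFlag_append _ hlen'', endFlag_append _ hlen', endFlag_append _ h₁.length_eq]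
  exact ⟨⟨⟨h₃, h₅⟩, hcongr.1.2 h₂⟩, hcongr.2⟩

include hT hST hu hv in
theorem IsGallery.exists_expand {l} (h : IsGallery S (u ++ coxeterWord n ++ v) l)
    (hn : endFlag S (u ++ coxeterWord n ++ v) l n = hyperplane A (n + 1)) :
    ∃ l', IsGallery T (shiftWord u ++ v) l' ∧ expandGallery n u T l' = l := by
  obtain ⟨l₀, l₃, rfl, h₀, h₃⟩ := h.exists_append
  obtain ⟨l₁, l₂, rfl, h₁, h₂⟩ := h₀.exists_append
  obtain ⟨l₁, h₁', rfl⟩ := h₁.exists_lift hT hST hu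
  have hT' := (hT.gallery_le (by
    intro i hi
    obtain ⟨j, hj, rfl⟩ := List.mem_map.1 hi
    have := hu j hj; omega) h₁').2
  have h₄ := (h₁'.lift hT hST hu).2
  -- As `v` omits the letter `n`, the condition on the final `n`-th member already holds at the end
  -- of `c`.
  rw [endFlag_append _ h₀.length_eq, endFlag_of_notMem fun hnv => (hv n hnv).2.false,
    endFlag_append _ h₁.length_eq] at hn
  rw [endFlag_append _ h₁.length_eq] at h₃
  have h₆ := (h₄.isMixed.isGallery hT' n.zero_le).2
  obtain rfl := h₄.isMixed.eq_of_isGallery hT' n.zero_le h₂ hn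
  have hlen : l₁.length = u.length := by rw [h₁'.length_eq, shiftWord, List.length_map]
  have hcongr := isGallery_congr h₆ (w := v) (fun i hi => by have := hv i hi; omega) (l := l₃)
  refine ⟨l₁ ++ l₃, (isGallery_append h₁'.length_eq).2 ⟨h₁', hcongr.1.1 h₃⟩, ?_⟩
  rw [expandGallery_append hlen]
  rfl

include hT hu in
-- The `u`-part is recovered by intersecting with the hyperplane, and the `v`-part is copied
-- unchanged.
theorem IsGallery.expand_injective {l l'} (h : IsGallery T (shiftWord u ++ v) l)
    (h' : IsGallery T (shiftWord u ++ v) l') (e : expandGallery n u T l = expandGallery n u T l') :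
    l = l' := by
  obtain ⟨l₁, l₂, rfl, h₁, h₂⟩ := h.exists_append
  obtain ⟨l₁', l₂', rfl, h₁', h₂'⟩ := h'.exists_append
  have hlen : l₁.length = u.length := by rw [h₁.length_eq, shiftWord, List.length_map]
  have hlen' : l₁'.length = u.length := by rw [h₁'.length_eq, shiftWord, List.length_map]
  have hlt : ∀ i ∈ shiftWord u, i < n := by
    intro i hi
    obtain ⟨j, hj, rfl⟩ := List.mem_map.1 hi
    have := hu j hj; omega
  have key : ∀ l : List (Submodule A (Fin (n + 1) → A)), (∀ H ∈ l, H ≤ hyperplane A (n + 1)) →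
      (l.map (stdSub A (n + 1) 1 ⊔ ·)).map (· ⊓ hyperplane A (n + 1)) = l := fun l hl => by
    rw [List.map_map]
    exact (List.map_congr_left fun H hH => sup_inf_hyperplane (hl H hH)).trans (List.map_id l)
  rw [expandGallery_append hlen, expandGallery_append hlen'] at e
  obtain ⟨e₁, e₂⟩ := List.append_inj e (by simp [hlen, hlen'])
  have e₃ := (List.append_inj e₁ (by simp [hlen, hlen'])).1
  rw [e₂, ← key l₁ (hT.gallery_le hlt h₁).1, e₃, key l₁' (hT.gallery_le hlt h₁').1]

end Expand

/-! ### The standard flag and its rotation as starting flags -/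

theorem isHyperplaneFlag_rotated_stdSub :
    IsHyperplaneFlag n fun a => permSub (coxeterElt n) (stdSub A (n + 1) a) where
  le_hyperplane a ha x hx := mem_hyperplane.2 ((mem_rotated_stdSub ha).1 hx).1
  last := rotated_stdSub_last
  top := by
    rw [stdSub_self, eq_top_iff]
    exact fun x _ => mem_permSub.2 trivial
  isSubbundle a ha := (isSubbundle_stdSub (by omega)).permSub _
  le_succ a _ := permSub_mono _ (stdSub_mono a.le_succ)

theorem isLift_rotated_stdSub :
    IsLift n (stdSub A (n + 1)) fun a => permSub (coxeterElt n) (stdSub A (n + 1) a) where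
  zero := by rw [stdSub_zero, permSub, Submodule.map_bot]
  succ _ ha := (line_sup_rotated_stdSub ha).symm

end Galleries

section Bridge

/-! ### Points of Bott--Samelson varieties as galleries -/

/-- The value of a family at a position, with prescribed value at `-∞`. -/
def valueAt {α : Type*} {r : ℕ} (s : α) (V : Fin r → α) (o : WithBot (Fin r)) : α :=
  WithBot.recBotCoe s V o

/-- Monotonicity is required only on the selected positions: a reordering of a word need not
preserve the order of the others. -/
theorem valueAt_max_reindex {α : Type*} {r r' : ℕ} (s : α) (V : Fin r' → α) (σ : Fin r ≃ Fin r')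
    (P : Fin r → Prop) (Q : Fin r' → Prop) [DecidablePred P] [DecidablePred Q]
    (hPQ : ∀ j, Q (σ j) ↔ P j) (hσ : ∀ i j, P i → P j → i ≤ j → σ i ≤ σ j) :
    valueAt s V (Finset.univ.filter Q).max =
      valueAt s (fun j => V (σ j)) (Finset.univ.filter P).max := by
  cases h : (Finset.univ.filter P).max using WithBot.recBotCoe with
  | bot =>
    have h' : (Finset.univ.filter Q).max = ⊥ := by
      rw [Finset.max_eq_bot, Finset.filter_eq_empty_iff] at h ⊢
      intro i _ hi
      obtain ⟨j, rfl⟩ := σ.surjective i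
      exact h (Finset.mem_univ j) ((hPQ j).1 hi)
    rw [h']; rfl
  | coe j =>
    have hj : P j := by simpa using Finset.mem_of_max h
    have h' : (Finset.univ.filter Q).max = σ j := by
      refine le_antisymm (Finset.max_le fun i hi => ?_) (Finset.le_max (by simpa [hPQ] using hj))
      obtain ⟨i, rfl⟩ := σ.surjective i
      have hi : P i := by simpa [hPQ] using hi
      exact WithBot.coe_le_coe.2 (hσ i j hi hj (Finset.le_max_of_eq (by simpa using hi) h))
    rw [h']; rfl

/-- The first position matters only if no later one is selected, so its value can be absorbed into
the default. This turns the convention at `-∞` into an update of the starting flag. -/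
theorem valueAt_max_succ {α : Type*} {r : ℕ} (s : α) (V : Fin (r + 1) → α)
    (P : Fin (r + 1) → Prop) [DecidablePred P] :
    valueAt s V (Finset.univ.filter P).max =
      valueAt (if P 0 then V 0 else s) (fun j => V j.succ)
        (Finset.univ.filter fun j => P j.succ).max := by
  cases h : (Finset.univ.filter fun j : Fin r => P j.succ).max using WithBot.recBotCoe with
  | bot =>
    rw [Finset.max_eq_bot, Finset.filter_eq_empty_iff] at h
    have h0 : ∀ i, P i → i = 0 := fun i hi => by
      cases i using Fin.cases with
      | zero => rfl
      | succ i => exact absurd hi (h (Finset.mem_univ i))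
    by_cases hP : P 0
    · have : (Finset.univ.filter P) = {0} := by
        ext i
        simp only [Finset.mem_filter, Finset.mem_univ, true_and, Finset.mem_singleton]
        exact ⟨h0 i, fun h => h ▸ hP⟩
      rw [this, Finset.max_singleton, if_pos hP]; rfl
    · have : (Finset.univ.filter P) = ∅ := by
        rw [Finset.filter_eq_empty_iff]
        exact fun i _ hi => hP (h0 i hi ▸ hi)
      rw [this, Finset.max_empty, if_neg hP]; rfl
  | coe j =>
    have hj : P j.succ := by simpa using Finset.mem_of_max h
    have h' : (Finset.univ.filter P).max = j.succ := by
      refine le_antisymm (Finset.max_le fun i hi => ?_) (Finset.le_max (by simpa using hj))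
      have hi : P i := by simpa using hi
      cases i using Fin.cases with
      | zero => exact WithBot.coe_le_coe.2 (Fin.zero_le _)
      | succ i =>
        exact WithBot.coe_le_coe.2 (Fin.succ_le_succ_iff.2
          (Finset.le_max_of_eq (by simpa using hi) h))
    rw [h']; rfl

theorem valueAt_lastOcc_cons {α : Type*} (S : ℕ → α) (i : ℕ) (w : List ℕ)
    (V : Fin (i :: w).length → α) (a : ℕ) :
    valueAt (S a) V (lastOcc (i :: w) a) =
      valueAt (Function.update S i (V ⟨0, by simp⟩) a) (fun j : Fin w.length => V j.succ)
        (lastOcc w a) := by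
  refine (valueAt_max_succ (r := w.length) (S a) V _).trans ?_
  rw [lastOcc]
  congr 1
  by_cases h : a = i
  · subst h; simp
  · rw [Function.update_of_ne h, if_neg]; exact fun h' => h h'.symm

theorem valueAt_lastOccUpTo_cons {α : Type*} (S : ℕ → α) (i : ℕ) (w : List ℕ)
    (V : Fin (i :: w).length → α) (k : Fin w.length) (a : ℕ) :
    valueAt (S a) V (lastOccUpTo (i :: w) k.succ a) =
      valueAt (Function.update S i (V ⟨0, by simp⟩) a) (fun j : Fin w.length => V j.succ)
        (lastOccUpTo w k a) := by
  refine (valueAt_max_succ (r := w.length) (S a) V _).trans ?_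
  rw [lastOccUpTo]
  congr 1
  · by_cases h : a = i
    · subst h; simp
    · rw [Function.update_of_ne h, if_neg]; exact fun h' => h h'.2.symm
  · congr 1
    ext j
    simp only [Finset.mem_filter, Finset.mem_univ, true_and]
    exact and_congr Fin.succ_le_succ_iff Iff.rfl

theorem lastOccUpTo_cons_zero (i : ℕ) (w : List ℕ) (a : ℕ) (h : i ≠ a) :
    lastOccUpTo (i :: w) ⟨0, by simp⟩ a = ⊥ := by
  rw [lastOccUpTo, Finset.max_eq_bot, Finset.filter_eq_empty_iff]
  rintro j - ⟨hj, hj'⟩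
  have : j = ⟨0, by simp⟩ := Fin.ext (Nat.le_zero.1 hj)
  subst this
  exact h hj'

theorem valueAt_lastOcc {α : Type*} (S : ℕ → α) (w : List ℕ) (V : Fin w.length → α) (a : ℕ) :
    valueAt (S a) V (lastOcc w a) = endFlag S w (List.ofFn V) a := by
  induction w generalizing S with
  | nil => rfl
  | cons i w ih =>
    rw [valueAt_lastOcc_cons, ih]
    have : List.ofFn V = V ⟨0, by simp⟩ :: List.ofFn fun j : Fin w.length => V j.succ :=
      List.ofFn_succ (n := w.length) (f := V)
    rw [this, endFlag]

variable {A B : Type u} [CommRing A] [CommRing B] {m n : ℕ}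

/-- The left and right predecessors of a position point to the members of index `i_k ∓ 1` of the
flag current at that moment, or to the starting flag if there is none. -/
theorem isGallery_ofFn {w : List ℕ} (hw : ∀ i ∈ w, 1 ≤ i) (S : ℕ → Submodule A (Fin m → A))
    (V : Fin w.length → Submodule A (Fin m → A)) :
    IsGallery S w (List.ofFn V) ↔ ∀ k, IsSubbundle (w.get k) (V k) ∧
      valueAt (S (w.get k - 1)) V (leftPred w k) ≤ V k ∧
      V k ≤ valueAt (S (w.get k + 1)) V (rightPred w k) := by
  induction w generalizing S with
  | nil => exact ⟨fun _ k => k.elim0, fun _ => .nil S⟩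
  | cons i w ih =>
    have hi := hw i (by simp)
    have hV : List.ofFn V = V ⟨0, by simp⟩ :: List.ofFn fun j : Fin w.length => V j.succ :=
      List.ofFn_succ (n := w.length) (f := V)
    rw [hV, isGallery_cons, ih fun j hj => hw j (by simp [hj])]
    refine Iff.trans ?_ (Fin.forall_fin_succ (n := w.length)).symm
    rw [← and_assoc, ← and_assoc]
    refine and_congr ?_ (forall_congr' fun k => ?_)
    · rw [and_assoc]
      refine and_congr Iff.rfl (and_congr ?_ ?_)
      -- The bound `1 ≤ i` is needed for `i - 1 ≠ i`; otherwise the position would be its own left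
      -- predecessor.
      · have : leftPred (i :: w) ⟨0, by simp⟩ = ⊥ :=
          lastOccUpTo_cons_zero i w (i - 1) (by omega)
        exact Eq.to_iff (congrArg (fun o => valueAt (S (i - 1)) V o ≤ V ⟨0, by simp⟩) this.symm)
      · have : rightPred (i :: w) ⟨0, by simp⟩ = ⊥ :=
          lastOccUpTo_cons_zero i w (i + 1) (by omega)
        exact Eq.to_iff (congrArg (fun o => V ⟨0, by simp⟩ ≤ valueAt (S (i + 1)) V o) this.symm)
    · refine and_congr Iff.rfl (and_congr ?_ ?_)
      · have := valueAt_lastOccUpTo_cons S i w V k (w.get k - 1)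
        exact Eq.to_iff (congrArg (fun N => N ≤ V k.succ) this.symm)
      · have := valueAt_lastOccUpTo_cons S i w V k (w.get k + 1)
        exact Eq.to_iff (congrArg (fun N => V k.succ ≤ N) this.symm)

theorem isBS_iff {w : List ℕ} (hw : IsWord n w)
    (V : Fin w.length → Submodule A (Fin (n + 1) → A)) :
    IsBS n w V ↔ IsGallery (stdSub A (n + 1)) w (List.ofFn V) := by
  rw [isGallery_ofFn fun i hi => (hw i hi).1]
  exact ⟨fun h k => ⟨h.isSubbundle k, h.left_le k, h.le_right k⟩,
    fun h => ⟨fun k => (h k).1, fun k => (h k).2.1, fun k => (h k).2.2⟩⟩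

theorem member_lastOcc (w : List ℕ) (V : Fin w.length → Submodule A (Fin m → A)) (a : ℕ) :
    member V a (lastOcc w a) = endFlag (stdSub A m) w (List.ofFn V) a :=
  valueAt_lastOcc (stdSub A m) w V a

theorem isRotatedBS_iff {w : List ℕ} (hw : IsWord n w)
    (H : Fin w.length → Submodule A (Fin (n + 1) → A)) :
    (∃ V, IsBS n w V ∧ ∀ j, H j = permSub (coxeterElt n) (V j)) ↔
      IsGallery (fun a => permSub (coxeterElt n) (stdSub A (n + 1) a)) w (List.ofFn H) := by
  constructor
  · rintro ⟨V, hV, hH⟩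
    have := ((isBS_iff hw V).1 hV).permSub (coxeterElt n)
    rw [List.map_ofFn] at this
    convert this using 2
    exact funext hH
  · intro h
    refine ⟨fun j => permSub (coxeterElt n).symm (H j), ?_, fun j =>
      (permSub_permSub_symm _ _).symm⟩
    have := h.permSub (coxeterElt n).symm
    simp only [permSub_symm_permSub, List.map_ofFn] at this
    exact (isBS_iff hw _).2 this

theorem permSub_member_lastOcc (σ : Equiv.Perm (Fin m)) (w : List ℕ)
    (H : Fin w.length → Submodule A (Fin m → A)) (a : ℕ) :
    permSub σ (member (fun j => permSub σ.symm (H j)) a (lastOcc w a)) =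
      endFlag (fun a => permSub σ (stdSub A m a)) w (List.ofFn H) a := by
  rw [member_lastOcc, ← endFlag_map (permSub σ), List.map_ofFn]
  congr 2
  exact funext fun j => permSub_permSub_symm _ _

theorem ofFn_getD {α : Type*} (l : List α) {r : ℕ} (h : l.length = r) (d : α) :
    (List.ofFn fun j : Fin r => l.getD j d) = l := by
  subst h
  refine List.ext_getElem (by simp) fun i h₁ h₂ => ?_
  simp

/-- Apart from copying, the expansion only adds the line `⟨e₁⟩`; applied to base change, this gives
naturality in the algebra. -/
theorem map_expandGallery (g : Submodule A (Fin (n + 1) → A) → Submodule B (Fin (n + 1) → B))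
    (hg : ∀ N, g (stdSub A (n + 1) 1 ⊔ N) = stdSub B (n + 1) 1 ⊔ g N) (u : List ℕ)
    (T : ℕ → Submodule A (Fin (n + 1) → A)) (l : List (Submodule A (Fin (n + 1) → A))) :
    (expandGallery n u T l).map g = expandGallery n u (fun a => g (T a)) (l.map g) := by
  simp only [expandGallery, List.map_append, List.map_map, List.map_drop, ← List.map_take]
  congr 2
  · refine List.map_congr_left fun N _ => hg N
  · refine List.map_congr_left fun a _ => ?_
    exact (endFlag_map g T (shiftWord u) _ a).symm

theorem baseChange_sup (f : A →+* B) (N N' : Submodule A (Fin m → A)) :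
    baseChange f (N ⊔ N') = baseChange f N ⊔ baseChange f N' := by
  conv_lhs => rw [← Submodule.span_eq N, ← Submodule.span_eq N', ← Submodule.span_union]
  rw [baseChange_span, Set.image_union, Submodule.span_union]
  rfl

end Bridge

/-! ### The fibre over `𝐅_n` as a pullback of functors of points -/

section Varieties

variable (k : Type u) [Field k] {n : ℕ} {u v : List ℕ}

/-- The morphism `c(X_{c⁻¹(u) v}) → X_{u c v}` identifying its source with the fibre over `𝐅_n`. -/
noncomputable def expandBS (hu : ∀ i ∈ u, 2 ≤ i ∧ i ≤ n) (hv : ∀ i ∈ v, 1 ≤ i ∧ i < n)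
    (huv : IsWord n (shiftWord u ++ v)) (hucv : IsWord n (u ++ coxeterWord n ++ v)) :
    rotatedBS k n (shiftWord u ++ v) ⟶ bottSamelson k n (u ++ coxeterWord n ++ v) where
  -- The default `⊥` is never reached, since the expanded gallery has the length of `u c v`.
  app A := ↾fun H => ⟨fun j => (expandGallery n u
      (fun a => permSub (coxeterElt n) (stdSub A (n + 1) a)) (List.ofFn H.1)).getD j ⊥, by
    have := (((isRotatedBS_iff huv H.1).1 H.2).expand isHyperplaneFlag_rotated_stdSub
      isLift_rotated_stdSub hu hv).1
    rw [isBS_iff hucv, ofFn_getD _ this.length_eq]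
    exact this⟩
  naturality A B f := by
    refine ConcreteCategory.hom_ext _ _ fun H => ?_
    have hA := (((isRotatedBS_iff huv H.1).1 H.2).expand isHyperplaneFlag_rotated_stdSub
      isLift_rotated_stdSub hu hv).1.length_eq
    have hB := (((isRotatedBS_iff huv _).1 ((rotatedBS k n (shiftWord u ++ v)).map f H).2).expand
      isHyperplaneFlag_rotated_stdSub isLift_rotated_stdSub hu hv).1.length_eq
    refine Subtype.ext (List.ofFn_injective ?_)
    refine (ofFn_getD _ hB _).trans ?_
    have h1 := List.map_ofFn (g := baseChange f.hom.toRingHom)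
      (f := (fun j : Fin (u ++ coxeterWord n ++ v).length => (expandGallery n u
      (fun a => permSub (coxeterElt n) (stdSub A (n + 1) a)) (List.ofFn H.1)).getD j ⊥))
    rw [ofFn_getD _ hA] at h1
    refine Eq.trans ?_ h1
    rw [map_expandGallery _ fun N => by rw [baseChange_sup, baseChange_stdSub]]
    simp only [baseChange_permSub, baseChange_stdSub, List.map_ofFn]
    rfl

theorem ofFn_expandBS (hu : ∀ i ∈ u, 2 ≤ i ∧ i ≤ n) (hv : ∀ i ∈ v, 1 ≤ i ∧ i < n)
    (huv : IsWord n (shiftWord u ++ v)) (hucv : IsWord n (u ++ coxeterWord n ++ v))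
    (A : CommAlgCat.{u} k) (H : (rotatedBS k n (shiftWord u ++ v)).obj A) :
    List.ofFn ((expandBS k hu hv huv hucv).app A H).1 = expandGallery n u
      (fun a => permSub (coxeterElt n) (stdSub A (n + 1) a)) (List.ofFn H.1) :=
  ofFn_getD _ (((isRotatedBS_iff huv H.1).1 H.2).expand isHyperplaneFlag_rotated_stdSub
      isLift_rotated_stdSub hu hv).1.length_eq _

theorem rotatedBSToFlag_app (w : List ℕ) (A : CommAlgCat.{u} k) (H : (rotatedBS k n w).obj A)
    (a : Fin (n + 2)) : ((rotatedBSToFlag k n w).app A H).1 a =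
      endFlag (fun a => permSub (coxeterElt n) (stdSub A (n + 1) a)) w (List.ofFn H.1) a :=
  permSub_member_lastOcc (coxeterElt n) w H.1 a

theorem bsToFlag_app (w : List ℕ) (A : CommAlgCat.{u} k) (V : (bottSamelson k n w).obj A)
    (a : Fin (n + 2)) : ((bsToFlag k n w).app A V).1 a =
      endFlag (stdSub A (n + 1)) w (List.ofFn V.1) a :=
  member_lastOcc w V.1 a

theorem expandBS_comp (hu : ∀ i ∈ u, 2 ≤ i ∧ i ≤ n) (hv : ∀ i ∈ v, 1 ≤ i ∧ i < n)
    (huv : IsWord n (shiftWord u ++ v)) (hucv : IsWord n (u ++ coxeterWord n ++ v)) :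
    expandBS k hu hv huv hucv ≫ bsToFlag k n (u ++ coxeterWord n ++ v) =
      rotatedBSToFlag k n (shiftWord u ++ v) := by
  refine NatTrans.ext (funext fun A => ConcreteCategory.hom_ext _ _ fun H => ?_)
  refine Subtype.ext (funext fun a => ?_)
  rw [rotatedBSToFlag_app]
  refine (bsToFlag_app k _ A ((expandBS k hu hv huv hucv).app A H) a).trans ?_
  rw [ofFn_expandBS]
  exact (((isRotatedBS_iff huv H.1).1 H.2).expand isHyperplaneFlag_rotated_stdSub
      isLift_rotated_stdSub hu hv).2 a (by omega)

/-- The factorization through `𝐅_n` of a morphism to `Fl_{n+1}`. -/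
def liftSubflag {k : Type u} [Field k] {X : CommAlgCat.{u} k ⥤ Type u} (f : X ⟶ flagVariety k n)
    (hf : ∀ A x, (f.app A x).1 (Fin.last n).castSucc = hyperplane A (n + 1)) :
    X ⟶ subflagVariety k n where
  app A := ↾fun x => ⟨(f.app A x).1, (f.app A x).2, hf A x⟩
  naturality A B φ := by
    refine ConcreteCategory.hom_ext _ _ fun x => Subtype.ext ?_
    have h : f.app B (X.map φ x) = (flagVariety k n).map φ (f.app A x) :=
      ConcreteCategory.congr_hom (f.naturality φ) x
    have h' := congrArg Subtype.val h
    exact h'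

/-- Pullbacks of functors are computed pointwise and `𝐅_n` is a subfunctor, so it suffices that `g`
is injective and hits every point lying over `𝐅_n`. -/
theorem isPullback_liftSubflag {k : Type u} [Field k] {X Y : CommAlgCat.{u} k ⥤ Type u} {g : X ⟶ Y}
    {q : Y ⟶ flagVariety k n} {f : X ⟶ flagVariety k n} (hgq : g ≫ q = f)
    (hf : ∀ A x, (f.app A x).1 (Fin.last n).castSucc = hyperplane A (n + 1))
    (hinj : ∀ A x x', g.app A x = g.app A x' → x = x')
    (hsurj : ∀ A y, (q.app A y).1 (Fin.last n).castSucc = hyperplane A (n + 1) →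
      ∃ x, g.app A x = y) :
    IsPullback g (liftSubflag f hf) q (subflagIncl k n) := by
  refine IsPullback.of_forall_isPullback_app fun A => (Types.isPullback_iff _ _ _ _).2
    ⟨congrArg (fun f => NatTrans.app f A) hgq, fun x x' h => hinj A x x' h.1, fun y U hyU => ?_⟩
  have hyU' : (q.app A y).1 = U.1 := congrArg Subtype.val hyU
  obtain ⟨x, rfl⟩ := hsurj A y (by rw [hyU', U.2.2])
  refine ⟨x, rfl, Subtype.ext (Eq.trans ?_ hyU')⟩
  have h : q.app A (g.app A x) = f.app A x :=
    ConcreteCategory.congr_hom (congrArg (fun f => NatTrans.app f A) hgq) x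
  exact (congrArg Subtype.val h).symm

theorem rotatedBSToFlag_last {w : List ℕ} (hw : n ∉ w) (A : CommAlgCat.{u} k)
    (H : (rotatedBS k n w).obj A) :
    ((rotatedBSToFlag k n w).app A H).1 (Fin.last n).castSucc = hyperplane A (n + 1) :=
  (rotatedBSToFlag_app k w A H _).trans ((endFlag_of_notMem hw).trans rotated_stdSub_last)

theorem isPullback_expandBS (hu : ∀ i ∈ u, 2 ≤ i ∧ i ≤ n) (hv : ∀ i ∈ v, 1 ≤ i ∧ i < n)
    (huv : IsWord n (shiftWord u ++ v)) (hucv : IsWord n (u ++ coxeterWord n ++ v))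
    (hn : n ∉ shiftWord u ++ v) :
    IsPullback (expandBS k hu hv huv hucv)
      (liftSubflag (rotatedBSToFlag k n (shiftWord u ++ v)) (rotatedBSToFlag_last k hn))
      (bsToFlag k n (u ++ coxeterWord n ++ v)) (subflagIncl k n) := by
  refine isPullback_liftSubflag (expandBS_comp k hu hv huv hucv) _ (fun A H H' h => ?_)
    fun A V hV => ?_
  · have h' := congrArg (fun V : (bottSamelson k n (u ++ coxeterWord n ++ v)).obj A =>
      List.ofFn V.1) h
    simp only [ofFn_expandBS] at h'
    exact Subtype.ext (List.ofFn_injective (((isRotatedBS_iff huv H.1).1 H.2).expand_injective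
      isHyperplaneFlag_rotated_stdSub hu ((isRotatedBS_iff huv H'.1).1 H'.2) h'))
  · obtain ⟨l, hl, hlV⟩ := ((isBS_iff hucv V.1).1 V.2).exists_expand
      isHyperplaneFlag_rotated_stdSub isLift_rotated_stdSub hu hv
      ((bsToFlag_app k _ A V (Fin.last n).castSucc).symm.trans hV)
    let H : (rotatedBS k n (shiftWord u ++ v)).obj A := ⟨fun j => l.getD j ⊥, by
      rw [isRotatedBS_iff huv, ofFn_getD _ hl.length_eq]; exact hl⟩
    refine ⟨H, Subtype.ext (List.ofFn_injective ?_)⟩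
    rw [ofFn_expandBS, ofFn_getD _ hl.length_eq, hlV]

/-! ### Invariance under commutation -/

/-- A bijection between the positions of two words which preserves the letters and the relative
order of those letters that do not commute. -/
structure Reordering (w w' : List ℕ) where
  toEquiv : Fin w.length ≃ Fin w'.length
  get_eq : ∀ j, w'.get (toEquiv j) = w.get j
  le_iff : ∀ i j, w.get i ≤ w.get j + 1 → w.get j ≤ w.get i + 1 →
    (toEquiv i ≤ toEquiv j ↔ i ≤ j)

namespace Reordering

variable {w w' w'' : List ℕ}

def refl (w : List ℕ) : Reordering w w := ⟨Equiv.refl _, fun _ => rfl, fun _ _ _ _ => Iff.rfl⟩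

def symm (σ : Reordering w w') : Reordering w' w where
  toEquiv := σ.toEquiv.symm
  get_eq j := by rw [← σ.get_eq, Equiv.apply_symm_apply]
  le_iff i j h h' := by
    have := σ.le_iff (σ.toEquiv.symm i) (σ.toEquiv.symm j)
    rw [← σ.get_eq, ← σ.get_eq, Equiv.apply_symm_apply, Equiv.apply_symm_apply] at this
    exact (this h h').symm

def trans (σ : Reordering w w') (τ : Reordering w' w'') : Reordering w w'' where
  toEquiv := σ.toEquiv.trans τ.toEquiv
  get_eq j := by rw [Equiv.trans_apply, τ.get_eq, σ.get_eq]
  le_iff i j h h' := by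
    rw [Equiv.trans_apply, Equiv.trans_apply, τ.le_iff _ _ (by simpa only [σ.get_eq])
      (by simpa only [σ.get_eq]), σ.le_iff i j h h']

variable {A : Type u} [CommRing A] {m : ℕ}

theorem member_lastOcc (σ : Reordering w w') (V : Fin w'.length → Submodule A (Fin m → A))
    (a : ℕ) : member (fun j => V (σ.toEquiv j)) a (lastOcc w a) = member V a (lastOcc w' a) :=
  (valueAt_max_reindex _ _ σ.toEquiv _ _ (fun j => by rw [σ.get_eq]) fun i j hi hj hij =>
    (σ.le_iff i j (by omega) (by omega)).2 hij).symm

/-- Only positions whose letters differ by at most one are compared, and a reordering preserves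
their relative order. -/
theorem member_lastOccUpTo (σ : Reordering w w') (V : Fin w'.length → Submodule A (Fin m → A))
    (p : Fin w.length) (a b : ℕ) (ha : w.get p ≤ a + 1) (ha' : a ≤ w.get p + 1) :
    member (fun j => V (σ.toEquiv j)) b (lastOccUpTo w p a) =
      member V b (lastOccUpTo w' (σ.toEquiv p) a) :=
  (valueAt_max_reindex _ _ σ.toEquiv _ _ (fun j => by
    rw [σ.get_eq]
    refine and_congr_left fun hj => σ.le_iff j p (by omega) (by omega)) fun i j hi hj hij =>
    (σ.le_iff i j (by omega) (by omega)).2 hij).symm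

theorem isBS (σ : Reordering w w') {V : Fin w'.length → Submodule A (Fin (n + 1) → A)}
    (hV : IsBS n w' V) : IsBS n w fun j => V (σ.toEquiv j) where
  isSubbundle p := σ.get_eq p ▸ hV.isSubbundle (σ.toEquiv p)
  left_le p := by
    rw [leftPred, σ.member_lastOccUpTo V p _ _ (by omega) (by omega)]
    have := hV.left_le (σ.toEquiv p)
    rwa [leftPred, σ.get_eq] at this
  le_right p := by
    rw [rightPred, σ.member_lastOccUpTo V p _ _ (by omega) (by omega)]
    have := hV.le_right (σ.toEquiv p)
    rwa [rightPred, σ.get_eq] at this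

/-- The isomorphism of Bott--Samelson varieties defined by a reordering. -/
def bsIso (σ : Reordering w w') (n : ℕ) : bottSamelson k n w' ≅ bottSamelson k n w where
  hom :=
    { app _ := ↾fun V => ⟨fun j => V.1 (σ.toEquiv j), σ.isBS V.2⟩
      naturality _ _ _ := rfl }
  inv :=
    { app _ := ↾fun V => ⟨fun j => V.1 (σ.symm.toEquiv j), σ.symm.isBS V.2⟩
      naturality _ _ _ := rfl }
  hom_inv_id := by
    refine NatTrans.ext (funext fun A => ConcreteCategory.hom_ext _ _ fun V => ?_)
    exact Subtype.ext (funext fun j => congrArg V.1 (σ.toEquiv.apply_symm_apply j))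
  inv_hom_id := by
    refine NatTrans.ext (funext fun A => ConcreteCategory.hom_ext _ _ fun V => ?_)
    exact Subtype.ext (funext fun j => congrArg V.1 (σ.toEquiv.symm_apply_apply j))

theorem bsIso_hom_comp (σ : Reordering w w') (n : ℕ) :
    (σ.bsIso k n).hom ≫ bsToFlag k n w = bsToFlag k n w' := by
  refine NatTrans.ext (funext fun A => ConcreteCategory.hom_ext _ _ fun V => ?_)
  exact Subtype.ext (funext fun a => σ.member_lastOcc V.1 a)

end Reordering

/-- Exchanging two adjacent positions changes the relative order of that pair only, and its letters
differ by at least 2. -/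
theorem CommStep.nonempty_reordering {w w' : List ℕ} (h : CommStep w w') :
    Nonempty (Reordering w w') := by
  obtain ⟨x, y, a, b, hab⟩ := h
  have hlen : (x ++ a :: b :: y).length = (x ++ b :: a :: y).length := by simp
  let p : Fin (x ++ b :: a :: y).length := ⟨x.length, by simp⟩
  let q : Fin (x ++ b :: a :: y).length := ⟨x.length + 1, by simp⟩
  let e := (finCongr hlen).trans (Equiv.swap p q)
  have he : ∀ j, (e j : ℕ) = if (j : ℕ) = x.length then x.length + 1 else
      if (j : ℕ) = x.length + 1 then x.length else j := fun j => by
    simp only [e, p, q, Equiv.trans_apply, Equiv.swap_apply_def, Fin.ext_iff, finCongr_apply,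
      Fin.val_cast]
    split_ifs <;> rfl
  have hget : ∀ j, (x ++ b :: a :: y).get (e j) = (x ++ a :: b :: y).get j := fun j => by
    have hj := he j
    rw [List.get_eq_getElem, List.get_eq_getElem, ← Option.some_inj, ← List.getElem?_eq_getElem,
      ← List.getElem?_eq_getElem, hj]
    rcases lt_trichotomy (j : ℕ) x.length with h | h | h
    · rw [if_neg (by omega), if_neg (by omega), List.getElem?_append_left h,
        List.getElem?_append_left h]
    · rw [if_pos h, h, List.getElem?_append_right (by omega), List.getElem?_append_right le_rfl]
      simp
    · obtain ⟨c, hc⟩ := Nat.exists_eq_add_of_lt h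
      rw [if_neg (by omega), hc]
      rcases c with _ | c
      · rw [if_pos (by omega), List.getElem?_append_right le_rfl,
          List.getElem?_append_right (by omega)]
        simp
      · rw [if_neg (by omega), List.getElem?_append_right (by omega),
          List.getElem?_append_right (by omega),
          show x.length + (c + 1) + 1 - x.length = c + 2 by omega]
        simp
  have hp : ∀ j : Fin (x ++ a :: b :: y).length, (j : ℕ) = x.length →
      (x ++ a :: b :: y).get j = a := fun j hj => by
    rw [List.get_eq_getElem, ← Option.some_inj, ← List.getElem?_eq_getElem, hj]
    simp
  have hq : ∀ j : Fin (x ++ a :: b :: y).length, (j : ℕ) = x.length + 1 →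
      (x ++ a :: b :: y).get j = b := fun j hj => by
    rw [List.get_eq_getElem, ← Option.some_inj, ← List.getElem?_eq_getElem, hj]
    simp
  refine ⟨⟨e, hget, fun i j h h' => ?_⟩⟩
  rw [Fin.le_def, Fin.le_def, he, he]
  have hip := hp i
  have hiq := hq i
  have hjp := hp j
  have hjq := hq j
  split_ifs <;> omega

theorem CommEquiv.nonempty_reordering {w w' : List ℕ} (h : CommEquiv w w') :
    Nonempty (Reordering w w') := by
  induction h with
  | rel _ _ h => exact h.nonempty_reordering
  | refl w => exact ⟨.refl w⟩
  | symm _ _ _ ih => exact ih.map Reordering.symm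
  | trans _ _ _ _ _ ih ih' => exact ih.elim fun σ => ih'.map σ.trans

/-- Over a nonzero algebra `e₁` does not lie in the hyperplane, so it has been expelled from the
`n`-th member of the final flag. -/
theorem coxeterWord_sublist_of_fibre {w : List ℕ} (hw : IsWord n w) {A : CommAlgCat.{u} k}
    [Nontrivial A] (x : (pullback (bsToFlag k n w) (subflagIncl k n)).obj A) :
    (coxeterWord n).Sublist w := by
  let V := (pullback.fst (bsToFlag k n w) (subflagIncl k n)).app A x
  let U := (pullback.snd (bsToFlag k n w) (subflagIncl k n)).app A x
  have hVU : (bsToFlag k n w).app A V = (subflagIncl k n).app A U :=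
    ConcreteCategory.congr_hom (congrArg (fun f => NatTrans.app f A)
      (pullback.condition (f := bsToFlag k n w) (g := subflagIncl k n))) x
  refine ((isBS_iff hw V.1).1 V.2).range'_sublist ?_
  have hlast : endFlag (stdSub A (n + 1)) w (List.ofFn V.1) n = hyperplane A (n + 1) := by
    rw [← U.2.2]
    exact (bsToFlag_app k _ A V (Fin.last n).castSucc).symm.trans
      (congrFun (congrArg Subtype.val hVU) _)
  rw [hlast, mem_hyperplane, Pi.single_eq_same]
  exact one_ne_zero

end Varieties

end BottSamelson

theorem theorem4p9 (k : Type u) [Field k] [IsAlgClosed k] [CharZero k] (n : ℕ) (hn : 1 ≤ n)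
    (w : List ℕ) (hw : IsReducedWord n w) :
    (¬ BruhatLE n (coxeterElt n) (wordPerm n w) →
      IsEmptyVariety (pullback (bsToFlag k n w) (subflagIncl k n))) ∧
    (BruhatLE n (coxeterElt n) (wordPerm n w) →
      ∃ u v : List ℕ, IsWord n u ∧ 1 ∉ u ∧ IsWord n v ∧ n ∉ v ∧
        CommEquiv w (u ++ coxeterWord n ++ v) ∧
        Nonempty
          (Over.mk (pullback.fst (bsToFlag k n w) (subflagIncl k n) ≫ bsToFlag k n w) ≅
            Over.mk (rotatedBSToFlag k n (shiftWord u ++ v)))) := by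
  constructor
  · exact fun h A _ => ⟨fun x =>
      h (bruhatLE_of_coxeterWord_sublist hw (coxeterWord_sublist_of_fibre k hw.1 x))⟩
  · intro h
    obtain ⟨u, v, hu, hu1, hv, hvn, huv⟩ :=
      hw.exists_commEquiv (coxeterWord_sublist_of_bruhatLE hw h)
    refine ⟨u, v, hu, hu1, hv, hvn, huv, ?_⟩
    have hu' : ∀ i ∈ u, 2 ≤ i ∧ i ≤ n := fun i hi => by
      have h1 := hu i hi
      have h2 : i ≠ 1 := fun h => hu1 (h ▸ hi)
      omega
    have hv' : ∀ i ∈ v, 1 ≤ i ∧ i < n := fun i hi => by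
      have h1 := hv i hi
      have h2 : i ≠ n := fun h => hvn (h ▸ hi)
      omega
    have hlt : ∀ i ∈ shiftWord u ++ v, 1 ≤ i ∧ i < n := fun i hi => by
      rcases List.mem_append.1 hi with hi | hi
      · obtain ⟨j, hj, rfl⟩ := List.mem_map.1 hi
        have := hu' j hj
        omega
      · exact hv' i hi
    obtain ⟨σ⟩ := huv.nonempty_reordering
    have huv' : IsWord n (shiftWord u ++ v) := fun i hi => ⟨(hlt i hi).1, (hlt i hi).2.le⟩
    have hucv : IsWord n (u ++ coxeterWord n ++ v) := fun i hi => hw.1 i (huv.perm.mem_iff.2 hi)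
    have hP := isPullback_expandBS k hu' hv' huv' hucv fun hmem => (hlt n hmem).2.false
    -- The reordering isomorphism lies over the identity of the flag variety. Pasting this square to
    -- the one for `u c v` transports the fibre to `w`.
    have hσ : IsPullback (σ.bsIso k n).hom (bsToFlag k n (u ++ coxeterWord n ++ v))
        (bsToFlag k n w) (𝟙 _) :=
      IsPullback.of_horiz_isIso ⟨by rw [Category.comp_id, σ.bsIso_hom_comp k]⟩
    have hw' := hP.paste_horiz hσ
    rw [Category.comp_id] at hw'
    refine ⟨Over.isoMk hw'.isoPullback.symm ?_⟩
    simp only [Over.mk_left, Over.mk_hom, Iso.symm_hom]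
    rw [← hw'.isoPullback_inv_fst, Category.assoc, Category.assoc, σ.bsIso_hom_comp k, expandBS_comp]
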